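/- Consider formulae of multiplicative exponential linear logic (MELL), $A ::= X \mid 1 \mid \bot \mid A\otimes A \mid A ⅋ A \mid {!A} \mid {?A}$, where $X$ ranges over a countably infinite set of atomic formulae, on which linear negation $(\cdot)^\perp$ is an involution without fixed points, extended to all formulae by De Morgan duality. The *polarized fragment* $\mathrm{LL}_{pol}$ consists of the positive formulae $P$ and negative formulae $N$ generated by $$P ::= 1 \mid {!X} \mid {!N} \mid P\otimes P, \qquad N ::= \bot \mid {?X} \mid {?P} \mid N ⅋ N,$$ together with their sub-formulae (that is, with the atomic formulae). A sequent calculus proof (with the usual rules of MELL: axiom, cut, exchange, $\otimes$, $1$, $⅋$, $\bot$, promotion, dereliction, contraction, weakening) is *in* $\mathrm{LL}_{pol}$ if all formulae of all its sequents are in $\mathrm{LL}_{pol}$. A *proof-structure* of MELL is a finite directed acyclic graph with typed arcs whose nodes are labelled $\mathtt{ax}$, $\mathtt{cut}$, $1$, $\bot$, $\otimes$, $⅋$, $?\mathtt{d}$, $?\mathtt{c}$, $?\mathtt{w}$, $\bullet$ (with the usual numbers of premises and conclusions and the usual typing constraints; each conclusion of the structure is the premise of a $\bullet$ node, and the conclusions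 are ordered, as are the premises of each $\otimes$ and $⅋$ node) or are boxes. A box is a node without premises whose content is again a proof-structure: if the content has conclusions of types $?B_1,\dots,?B_k,A$, the box has conclusions of types $?B_1,\dots,?B_k,!A$. It is a proof-structure *of $\mathrm{LL}_{pol}$* if all its arcs, also inside boxes, have types in $\mathrm{LL}_{pol}$, and *cut-free* if it has no $\mathtt{cut}$ node, also inside boxes. Proof-structures are identified up to isomorphism. A *switching* $\varphi$ of a proof-structure $R$ selects, for each $⅋$ or $?\mathtt{c}$ node of the ground structure of $R$ (outside the boxes), one of its two premises; the *switching graph* $R^\varphi$ is obtained by redirecting each non-selected premise to a fresh $\bullet$ node. $R$ satisfies $\mathrm{ACC}_{\sharp w}$ if, for every switching $\varphi$, the graph $R^\varphi$ is acyclic (as an undirected graph, possibly with parallel arcs) and its number of connected components is exactly one more than the number of $\bot$ and $?\mathtt{w}$ nodes of the ground structure of $R$, and if, inductively, the content of every box of $R$ satisfies $\mathrm{ACC}_{\sharp w}$. $R$ is *sequentializable in $\mathrm{LL}_{pol}$* if there is a sequent calculus proof $\pi$ in $\mathrm{LL}_{pol}$ such that $R=\pi^\circ$, where $\pi^\circ$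 is the desequentialization of $\pi$, defined by induction on $\pi$: each rule adds the corresponding node (a binary rule first takes the disjoint union of the two structures, the promotion rule encloses the structure in a box, and the exchange rule only reorders the conclusions). **Statement.** Let $R$ be a cut-free proof-structure of $\mathrm{LL}_{pol}$. Then $R$ satisfies $\mathrm{ACC}_{\sharp w}$ if and only if $R$ is sequentializable in $\mathrm{LL}_{pol}$. -/

import Mathlib

namespace MELL

/-! ### Formulae -/

/-- Formulae of multiplicative exponential linear logic. The atomic formulae are `atom n b`, with
`n : ℕ` and `b : Bool`; linear negation exchanges `atom n true` and `atom n false`. -/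
inductive Formula : Type
  | atom (n : ℕ) (b : Bool)
  | one
  | bot
  | tensor (A B : Formula)
  | par (A B : Formula)
  | bang (A : Formula)
  | whynot (A : Formula)

/-- Linear negation. -/
def Formula.neg : Formula → Formula
  | .atom n b => .atom n (!b)
  | .one => .bot
  | .bot => .one
  | .tensor A B => .par A.neg B.neg
  | .par A B => .tensor A.neg B.neg
  | .bang A => .whynot A.neg
  | .whynot A => .bang A.neg

mutual

/-- Positive formulae `P ::= 1 | !X | !N | P ⊗ P`. -/
inductive IsPositive : Formula → Prop
  | one : IsPositive .one
  | bang_atom (n : ℕ) (b : Bool) : IsPositive (.bang (.atom n b))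
  | bang {N : Formula} : IsNegative N → IsPositive (.bang N)
  | tensor {P Q : Formula} : IsPositive P → IsPositive Q → IsPositive (.tensor P Q)

/-- Negative formulae `N ::= ⊥ | ?X | ?P | N ⅋ N`. -/
inductive IsNegative : Formula → Prop
  | bot : IsNegative .bot
  | whynot_atom (n : ℕ) (b : Bool) : IsNegative (.whynot (.atom n b))
  | whynot {P : Formula} : IsPositive P → IsNegative (.whynot P)
  | par {M N : Formula} : IsNegative M → IsNegative N → IsNegative (.par M N)

end

/-- The polarized fragment: positive formulae, negative formulae, and their remaining
sub-formulae, which are the atomic formulae. -/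
def LLpol : Set Formula :=
  {A | IsPositive A ∨ IsNegative A ∨ ∃ n b, A = .atom n b}

/-! ### Sequent calculus -/

/-- Sequent calculus proofs of MELL; sequents are finite sequences of formulae. -/
inductive Proof : List Formula → Type
  | ax (A : Formula) : Proof [A, A.neg]
  | cut {Γ Δ : List Formula} {A : Formula} :
      Proof (Γ ++ [A]) → Proof ([A.neg] ++ Δ) → Proof (Γ ++ Δ)
  | ex {Γ Δ : List Formula} {A B : Formula} :
      Proof (Γ ++ [A, B] ++ Δ) → Proof (Γ ++ [B, A] ++ Δ)
  | tensor {Γ Δ : List Formula} {A B : Formula} :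
      Proof (Γ ++ [A]) → Proof ([B] ++ Δ) → Proof (Γ ++ [.tensor A B] ++ Δ)
  | one : Proof [.one]
  | par {Γ : List Formula} {A B : Formula} : Proof (Γ ++ [A, B]) → Proof (Γ ++ [.par A B])
  | bot {Γ : List Formula} : Proof Γ → Proof (Γ ++ [.bot])
  | promotion {Γ : List Formula} {A : Formula} :
      Proof (Γ.map .whynot ++ [A]) → Proof (Γ.map .whynot ++ [.bang A])
  | dereliction {Γ : List Formula} {A : Formula} : Proof (Γ ++ [A]) → Proof (Γ ++ [.whynot A])
  | contraction {Γ : List Formula} {A : Formula} :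
      Proof (Γ ++ [.whynot A, .whynot A]) → Proof (Γ ++ [.whynot A])
  | weakening {Γ : List Formula} {A : Formula} : Proof Γ → Proof (Γ ++ [.whynot A])

/-- `π.InFragment F`: every sequent of the proof `π` consists of formulae of `F`. -/
def Proof.InFragment (F : Set Formula) : {Γ : List Formula} → Proof Γ → Prop
  | _, .ax A => ∀ C ∈ [A, A.neg], C ∈ F
  | _, .cut (Γ := Γ) (Δ := Δ) π₁ π₂ =>
      (∀ C ∈ Γ ++ Δ, C ∈ F) ∧ π₁.InFragment F ∧ π₂.InFragment F
  | _, .ex (Γ := Γ) (Δ := Δ) (A := A) (B := B) π =>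
      (∀ C ∈ Γ ++ [B, A] ++ Δ, C ∈ F) ∧ π.InFragment F
  | _, .tensor (Γ := Γ) (Δ := Δ) (A := A) (B := B) π₁ π₂ =>
      (∀ C ∈ Γ ++ [.tensor A B] ++ Δ, C ∈ F) ∧ π₁.InFragment F ∧ π₂.InFragment F
  | _, .one => ∀ C ∈ [Formula.one], C ∈ F
  | _, .par (Γ := Γ) (A := A) (B := B) π =>
      (∀ C ∈ Γ ++ [.par A B], C ∈ F) ∧ π.InFragment F
  | _, .bot (Γ := Γ) π => (∀ C ∈ Γ ++ [.bot], C ∈ F) ∧ π.InFragment F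
  | _, .promotion (Γ := Γ) (A := A) π =>
      (∀ C ∈ Γ.map .whynot ++ [.bang A], C ∈ F) ∧ π.InFragment F
  | _, .dereliction (Γ := Γ) (A := A) π =>
      (∀ C ∈ Γ ++ [.whynot A], C ∈ F) ∧ π.InFragment F
  | _, .contraction (Γ := Γ) (A := A) π =>
      (∀ C ∈ Γ ++ [.whynot A], C ∈ F) ∧ π.InFragment F
  | _, .weakening (Γ := Γ) (A := A) π =>
      (∀ C ∈ Γ ++ [.whynot A], C ∈ F) ∧ π.InFragment F

/-! ### Proof-structures -/

/-- Labels of nodes. The nodes labelled `•` in the usual presentation have exactly one premise and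
no conclusion; those of a proof-structure are represented by the arcs without a head. -/
inductive NodeLabel : Type
  | ax
  | cut
  | one
  | bot
  | tensor
  | par
  | der
  | con
  | weak
  | box

/-- The data of a typed ground structure: a labelled directed graph whose arcs are typed by
formulae. A box is a node, without premises, whose conclusions are those of the box. -/
structure Ground : Type 1 where
  Node : Type
  Arc : Type
  label : Node → NodeLabel
  /-- the type of an arc -/
  type : Arc → Formula
  tail : Arc → Node
  /-- the head of an arc; `none` stands for the `•` node of which the arc is the premise -/
  head : Arc → Option Node
  /-- the premises of a node; their order is relevant for `⊗` and `⅋` nodes only -/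
  prem : Node → List Arc
  /-- the conclusions of a node; their order is relevant for boxes only -/
  concl : Node → List Arc
  /-- the conclusions of the whole structure, in order -/
  concls : List Arc

/-- A ground structure and, for each of its boxes, the content of the box. -/
inductive PreStructure : Type 1
  | mk (G : Ground) (content : {v : G.Node // G.label v = .box} → PreStructure) : PreStructure

/-- The numbers of premises and of conclusions of a node which is not a box, and the constraints
on their types. -/
inductive NodeLabel.Typed : NodeLabel → List Formula → List Formula → Prop
  | ax (A : Formula) : Typed .ax [] [A, A.neg]
  | cut (A : Formula) : Typed .cut [A, A.neg] []
  | one : Typed .one [] [.one]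
  | bot : Typed .bot [] [.bot]
  | tensor (A B : Formula) : Typed .tensor [A, B] [.tensor A B]
  | par (A B : Formula) : Typed .par [A, B] [.par A B]
  | der (A : Formula) : Typed .der [A] [.whynot A]
  | con (A : Formula) : Typed .con [.whynot A, .whynot A] [.whynot A]
  | weak (A : Formula) : Typed .weak [] [.whynot A]

namespace Ground

/-- `G` is a finite directed acyclic graph, and the lists `prem`, `concl` and `concls` enumerate,
without repetitions, the premises of each node, its conclusions and the conclusions of `G`. -/
structure IsGraph (G : Ground) : Prop where
  finite_node : Finite G.Node
  finite_arc : Finite G.Arc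
  dag : ∀ v, ¬ Relation.TransGen (fun u w => ∃ a, G.tail a = u ∧ G.head a = some w) v v
  nodup_prem : ∀ v, (G.prem v).Nodup
  mem_prem : ∀ v a, a ∈ G.prem v ↔ G.head a = some v
  nodup_concl : ∀ v, (G.concl v).Nodup
  mem_concl : ∀ v a, a ∈ G.concl v ↔ G.tail a = v
  nodup_concls : G.concls.Nodup
  mem_concls : ∀ a, a ∈ G.concls ↔ G.head a = none

end Ground

namespace PreStructure

/-- The types of the conclusions, in order. -/
def conclTypes : PreStructure → List Formula
  | .mk G _ => G.concls.map G.type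

/-- `R` is a proof-structure of MELL. The conclusions of a box correspond, in order, to those of its
content: if the content has conclusions of types `?B₁, …, ?Bₖ, A`, then the box has conclusions of
types `?B₁, …, ?Bₖ, !A`. -/
def IsProofStructure : PreStructure → Prop
  | .mk G content =>
      G.IsGraph ∧
      (∀ v, G.label v ≠ .box →
        (G.label v).Typed ((G.prem v).map G.type) ((G.concl v).map G.type)) ∧
      ∀ v, G.prem v.1 = [] ∧ (content v).IsProofStructure ∧
        ∃ (Γ : List Formula) (A : Formula),
          (content v).conclTypes = Γ.map .whynot ++ [A] ∧
          (G.concl v.1).map G.type = Γ.map .whynot ++ [.bang A]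

/-- All the arcs of `R`, also inside the boxes, are typed by formulae of `F`. -/
def InFragment (F : Set Formula) : PreStructure → Prop
  | .mk G content => (∀ a, G.type a ∈ F) ∧ ∀ v, (content v).InFragment F

/-- `R` has no cut node, also inside the boxes. -/
def CutFree : PreStructure → Prop
  | .mk G content => (∀ v, G.label v ≠ .cut) ∧ ∀ v, (content v).CutFree

/-- Equality of proof-structures, that is isomorphism: a bijective renaming of nodes and arcs, at
every depth, respecting labels, types, incidence, the order of the premises of `⊗` and `⅋` nodes,
the order of the conclusions of the boxes and of the whole structure. -/
def Iso : PreStructure → PreStructure → Prop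
  | .mk G content, .mk G' content' =>
      ∃ (e : G.Node ≃ G'.Node) (f : G.Arc ≃ G'.Arc) (hlabel : ∀ v, G'.label (e v) = G.label v),
        (∀ a, G'.type (f a) = G.type a) ∧
        (∀ a, G'.tail (f a) = e (G.tail a)) ∧
        (∀ a, G'.head (f a) = (G.head a).map e) ∧
        (∀ v, G.label v = .tensor ∨ G.label v = .par → G'.prem (e v) = (G.prem v).map f) ∧
        (∀ v, G.label v = .box → G'.concl (e v) = (G.concl v).map f) ∧
        G'.concls = G.concls.map f ∧
        ∀ v, (content v).Iso (content' ⟨e v.1, (hlabel v.1).trans v.2⟩)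

end PreStructure

/-! ### Switchings and correctness -/

namespace Ground

/-- A switching maps every `⅋` or `?c` node to one of its premises. -/
def Switching (G : Ground) : Type :=
  (v : {v : G.Node // G.label v = .par ∨ G.label v = .con}) → {a : G.Arc // G.head a = some v.1}

variable {G : Ground}

/-- The arcs whose head, in the switching graph induced by `φ`, is a `•` node: the conclusions
of `G` and the premises of `⅋` and `?c` nodes which are not selected by `φ`. -/
def Switching.Pending (φ : G.Switching) (a : G.Arc) : Prop :=
  G.head a = none ∨ ∃ v, G.head a = some v.1 ∧ (φ v).1 ≠ a

/-- The nodes of the switching graph: the nodes of `G`, and one `•` node for each pending arc. -/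
abbrev Switching.Vertex (φ : G.Switching) : Type :=
  G.Node ⊕ {a : G.Arc // φ.Pending a}

/-- `φ.Incident x a`: the node `x` is an end of the arc `a` in the switching graph. -/
def Switching.Incident (φ : G.Switching) : φ.Vertex → G.Arc → Prop
  | .inl v, a => G.tail a = v ∨ (G.head a = some v ∧ ¬ φ.Pending a)
  | .inr b, a => b.1 = a

/-- The switching graph, which may have parallel arcs, as a simple bipartite graph between its
nodes and its arcs. As a path is an alternating sequence of nodes and incident arcs, paths
(between nodes), cycles and connected components are those of this simple graph. -/
def Switching.graph (φ : G.Switching) : SimpleGraph (φ.Vertex ⊕ G.Arc) :=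
  SimpleGraph.fromRel fun x y => ∃ u a, x = .inl u ∧ y = .inr a ∧ φ.Incident u a

/-- The number of `⊥` and `?w` nodes. -/
noncomputable def numW (G : Ground) : ℕ :=
  Nat.card {v : G.Node // G.label v = .bot ∨ G.label v = .weak}

end Ground

namespace PreStructure

/-- Every switching graph of the ground structure is acyclic, and so on inside the boxes. -/
def AC : PreStructure → Prop
  | .mk G content => (∀ φ : G.Switching, φ.graph.IsAcyclic) ∧ ∀ v, (content v).AC

/-- Every switching graph of the ground structure has exactly one more connected component than
there are `⊥` and `?w` nodes in the ground structure, and so on inside the boxes. -/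
def Cw : PreStructure → Prop
  | .mk G content =>
      (∀ φ : G.Switching, Nat.card φ.graph.ConnectedComponent = G.numW + 1) ∧
      ∀ v, (content v).Cw

/-- The conjunction of the two properties. -/
def ACCw (R : PreStructure) : Prop := R.AC ∧ R.Cw

end PreStructure

/-! ### Desequentialization -/

namespace Ground

/-- The empty graph. -/
abbrev empty : Ground where
  Node := Empty
  Arc := Empty
  label := Empty.elim
  type := Empty.elim
  tail := Empty.elim
  head := Empty.elim
  prem := Empty.elim
  concl := Empty.elim
  concls := []

/-- Disjoint union; the conclusions of `G` come before those of `H`. -/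
abbrev union (G H : Ground) : Ground where
  Node := G.Node ⊕ H.Node
  Arc := G.Arc ⊕ H.Arc
  label := Sum.elim G.label H.label
  type := Sum.elim G.type H.type
  tail := Sum.map G.tail H.tail
  head := Sum.elim (fun a => (G.head a).map .inl) (fun a => (H.head a).map .inr)
  prem := Sum.elim (fun v => (G.prem v).map .inl) (fun v => (H.prem v).map .inr)
  concl := Sum.elim (fun v => (G.concl v).map .inl) (fun v => (H.concl v).map .inr)
  concls := G.concls.map .inl ++ H.concls.map .inr

open Classical in
/-- Add to `G` a node labelled by `l` whose premises are the `k` conclusions of `G` following the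
first `i` ones, and whose conclusions, of types `outs`, take their place among the conclusions. -/
noncomputable abbrev addNode (G : Ground) (l : NodeLabel) (i k : ℕ) (outs : List Formula) :
    Ground where
  Node := G.Node ⊕ Unit
  Arc := G.Arc ⊕ Fin outs.length
  label := Sum.elim G.label (fun _ => l)
  type := Sum.elim G.type outs.get
  tail := Sum.map G.tail (fun _ => ())
  head := Sum.elim
    (fun a => if a ∈ (G.concls.drop i).take k then some (.inr ()) else (G.head a).map .inl)
    (fun _ => none)
  prem := Sum.elim (fun v => (G.prem v).map .inl) (fun _ => ((G.concls.drop i).take k).map .inl)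
  concl := Sum.elim (fun v => (G.concl v).map .inl) (fun _ => (List.finRange _).map .inr)
  concls := (G.concls.take i).map .inl ++ (List.finRange _).map .inr ++
    (G.concls.drop (i + k)).map .inl

/-- Exchange the conclusions of indices `i` and `i + 1` (indices start from `0`). -/
abbrev exchange (G : Ground) (i : ℕ) : Ground :=
  { G with
    concls := G.concls.take i ++ (G.concls.drop (i + 1)).take 1 ++ (G.concls.drop i).take 1 ++
      G.concls.drop (i + 2) }

end Ground

namespace PreStructure

/-- The empty structure. -/
def empty : PreStructure := .mk .empty fun v => v.1.elim

/-- Disjoint union. -/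
def union : PreStructure → PreStructure → PreStructure
  | .mk G c, .mk H d => .mk (G.union H) fun
      | ⟨.inl v, h⟩ => c ⟨v, h⟩
      | ⟨.inr v, h⟩ => d ⟨v, h⟩

/-- Add a node, together with its content in case it is a box. -/
noncomputable def addNode : PreStructure → (l : NodeLabel) → (l = .box → PreStructure) →
    ℕ → ℕ → List Formula → PreStructure
  | .mk G c, l, d, i, k, outs => .mk (G.addNode l i k outs) fun
      | ⟨.inl v, h⟩ => c ⟨v, h⟩
      | ⟨.inr _, h⟩ => d h

/-- Exchange the conclusions of indices `i` and `i + 1`. -/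
def exchange : PreStructure → ℕ → PreStructure
  | .mk G c, i => .mk (G.exchange i) c

end PreStructure

/-- The desequentialization of a sequent calculus proof. -/
noncomputable def Proof.deseq : {Γ : List Formula} → Proof Γ → PreStructure
  | _, .ax A => PreStructure.empty.addNode .ax nofun 0 0 [A, A.neg]
  | _, .cut (Γ := Γ) π₁ π₂ => (π₁.deseq.union π₂.deseq).addNode .cut nofun Γ.length 2 []
  | _, .ex (Γ := Γ) π => π.deseq.exchange Γ.length
  | _, .tensor (Γ := Γ) (A := A) (B := B) π₁ π₂ =>
      (π₁.deseq.union π₂.deseq).addNode .tensor nofun Γ.length 2 [.tensor A B]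
  | _, .one => PreStructure.empty.addNode .one nofun 0 0 [.one]
  | _, .par (Γ := Γ) (A := A) (B := B) π => π.deseq.addNode .par nofun Γ.length 2 [.par A B]
  | _, .bot (Γ := Γ) π => π.deseq.addNode .bot nofun Γ.length 0 [.bot]
  | _, .promotion (Γ := Γ) (A := A) π =>
      PreStructure.empty.addNode .box (fun _ => π.deseq) 0 0 (Γ.map .whynot ++ [.bang A])
  | _, .dereliction (Γ := Γ) (A := A) π => π.deseq.addNode .der nofun Γ.length 1 [.whynot A]
  | _, .contraction (Γ := Γ) (A := A) π => π.deseq.addNode .con nofun Γ.length 2 [.whynot A]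
  | _, .weakening (Γ := Γ) (A := A) π => π.deseq.addNode .weak nofun Γ.length 0 [.whynot A]

/-- `R` is sequentializable in `F`: it is the desequentialization of a proof in `F`. -/
def PreStructure.Sequentializable (F : Set Formula) (R : PreStructure) : Prop :=
  ∃ (Γ : List Formula) (π : Proof Γ), π.InFragment F ∧ R.Iso π.deseq

end MELL

-- Both directions rest on a numerical form of the criterion. In a finite graph the number of
-- vertices is at most the number of edges plus the number of components, with equality exactly for
-- forests (`card_le_and_isAcyclic_iff`). In a switching graph every pending arc only adds a leaf,
-- so everything can be read off the nodes and the set `L` of non-pending ("live") arcs. With `w`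
-- the number of `⊥` and `?w` nodes, the criterion says that for every such `L` there are `w + 1`
-- classes of linked nodes and `|L| + w + 1` nodes (`Ground.Correct`, `Ground.correct_iff`).
--
-- From proofs to structures, each rule preserves these two equations. A `⅋`, `?c` or `?d` node is
-- attached by exactly one live arc; a `⊥` or `?w` node is a new component, compensated by `w`; a
-- `⊗` or `cut` node fuses one component of each of two structures; `ax`, `1` and boxes start from
-- the empty structure (`Proof.sound_deseq`).
--
-- From structures to proofs, polarity removes the need for a splitting lemma. Call `⅋`, `?c`, `?d`,
-- `⊥` and `?w` nodes negative. The conclusion of such a node is not positive, while a `⊗` formula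
-- in the fragment has positive components. Hence, without cuts, the conclusion of a negative node
-- can only enter another negative node, and a last negative node is terminal
-- (`Ready.exists_isNeg_conclusion`). It can be removed without loss, since the equations above are
-- equivalent before and after.
--
-- If no negative node is left, there is a single switching and the structure is a tree of `ax`,
-- `1`, `⊗` nodes and boxes. Either it contains a terminal `⊗`, whose removal from a tree leaves two
-- trees, or it is a single leaf. This gives an induction on the number of nodes
-- (`Ready.sequentializableAs`), inside an induction on depth that treats the contents of boxes
-- first. The order of the conclusions is immaterial thanks to the exchange rule
-- (`SequentializableAs.perm`).

/-! ### Counting classes and components -/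

section Counting

variable {α : Type*}

/-- The number of classes of the equivalence relation generated by `r`. -/
noncomputable def numClasses (r : α → α → Prop) : ℕ := Nat.card (Quot r)

theorem numClasses_le_of_imp [Finite α] {r s : α → α → Prop} (h : ∀ a b, r a b → s a b) :
    numClasses s ≤ numClasses r :=
  Nat.card_le_card_of_surjective (Quot.map id h) fun q => by
    induction q using Quot.ind with | _ a => exact ⟨Quot.mk _ a, rfl⟩

theorem numClasses_eq_of_eqvGen {r s : α → α → Prop} (h : ∀ a b, r a b → s a b)
    (h' : ∀ a b, s a b → Relation.EqvGen r a b) : numClasses s = numClasses r :=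
  Nat.card_congr
    { toFun := Quot.lift (Quot.mk r) fun a b hab => Quot.eqvGen_sound (h' a b hab)
      invFun := Quot.map id h
      left_inv := fun q => by induction q using Quot.ind with | _ a => rfl
      right_inv := fun q => by induction q using Quot.ind with | _ a => rfl }

theorem numClasses_congr {β : Type*} {r : α → α → Prop} {s : β → β → Prop} (e : α ≃ β)
    (h : ∀ a b, r a b ↔ s (e a) (e b)) : numClasses r = numClasses s :=
  Nat.card_congr (Quot.congr e h)

/-- Linking two elements merges at most two classes. -/
theorem numClasses_le_add_one [Finite α] {r s : α → α → Prop} (x y : α)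
    (h : ∀ a b, s a b → r a b ∨ (a = x ∧ b = y)) : numClasses r ≤ numClasses s + 1 := by
  classical
  -- The extra point `none` covers the class of `y`. On the others, the class of `y` is redirected
  -- to that of `x`, so that `g` respects a possible link from `x` to `y`.
  let g : Option (Quot s) → Quot r := fun o => o.elim (Quot.mk r y) fun q =>
    Quot.lift (fun a => if Quot.mk r a = Quot.mk r y then Quot.mk r x else Quot.mk r a)
      (fun a b hab => by
        rcases h a b hab with h | ⟨rfl, rfl⟩
        · simp only [Quot.sound h]
        · simp) q
  have hg : Function.Surjective g := fun q => by
    by_cases hq : q = Quot.mk r y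
    · exact ⟨none, hq.symm⟩
    · induction q using Quot.ind with
      | _ a => exact ⟨some (Quot.mk s a), if_neg hq⟩
  simpa [numClasses, Finite.card_option] using Nat.card_le_card_of_surjective g hg

/-- Linking two elements of different classes merges these two classes. -/
theorem numClasses_eq_add_one [Finite α] {r s : α → α → Prop} {x y : α}
    (hrs : ∀ a b, r a b → s a b) (hxy : s x y) (hn : ¬ Relation.EqvGen r x y)
    (h : ∀ a b, s a b → r a b ∨ (a = x ∧ b = y)) : numClasses r = numClasses s + 1 := by
  refine le_antisymm (numClasses_le_add_one x y h) ?_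
  let f : Quot r → Quot s := Quot.map id hrs
  have hf : Function.Surjective f := fun q => by
    induction q using Quot.ind with | _ a => exact ⟨Quot.mk _ a, rfl⟩
  by_contra! hlt
  -- A surjection from a set that is not larger is injective, and would have put `x` and `y` in one
  -- class already.
  have hinj : Function.Injective f :=
    ((Nat.bijective_iff_surjective_and_card f).2
      ⟨hf, le_antisymm (Nat.lt_succ_iff.1 hlt) (numClasses_le_of_imp hrs)⟩).1
  exact hn (Quot.eqvGen_exact (hinj (a₁ := Quot.mk r x) (a₂ := Quot.mk r y) (Quot.sound hxy)))

theorem numClasses_eq_card [Finite α] {r : α → α → Prop} (h : ∀ a b, ¬ r a b) :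
    numClasses r = Nat.card α :=
  Nat.card_congr
    { toFun := Quot.lift id fun a b hab => (h a b hab).elim
      invFun := Quot.mk r
      left_inv := fun q => by induction q using Quot.ind with | _ a => rfl
      right_inv := fun _ => rfl }

end Counting

-- Counting criterion for forests

namespace SimpleGraph

variable {V : Type*}

theorem eqvGen_adj_iff {G : SimpleGraph V} {x y : V} :
    Relation.EqvGen G.Adj x y ↔ G.Reachable x y := by
  constructor
  · intro h
    induction h with
    | rel _ _ h => exact h.reachable
    | refl _ => exact .rfl
    | symm _ _ _ ih => exact ih.symm
    | trans _ _ _ _ _ ih₁ ih₂ => exact ih₁.trans ih₂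
  · rintro ⟨p⟩
    induction p with
    | nil => exact .refl _
    | cons h _ ih => exact (Relation.EqvGen.rel _ _ h).trans _ _ _ ih

theorem card_connectedComponent_eq (G : SimpleGraph V) :
    Nat.card G.ConnectedComponent = numClasses G.Adj :=
  Nat.card_congr
    { toFun := Quot.lift (Quot.mk _) fun _ _ h => Quot.eqvGen_sound (eqvGen_adj_iff.2 h)
      invFun := Quot.map id fun _ _ h => h.reachable
      left_inv := fun q => by induction q using Quot.ind with | _ a => rfl
      right_inv := fun q => by induction q using Quot.ind with | _ a => rfl }

/-- Delete one edge `xy`. If `x` and `y` remain connected, the edge was on a cycle, the components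
are unchanged and the inequality becomes strict. Otherwise the edge was a bridge: acyclicity is
unaffected and the lost edge is balanced by one more component. -/
theorem card_le_and_isAcyclic_iff [Finite V] (n : ℕ) (G : SimpleGraph V)
    (hn : G.edgeSet.ncard = n) :
    Nat.card V ≤ n + numClasses G.Adj ∧
      (G.IsAcyclic ↔ Nat.card V = n + numClasses G.Adj) := by
  induction n generalizing G with
  | zero =>
    have hG : G = ⊥ := by
      rw [← edgeSet_eq_empty]
      exact (Set.ncard_eq_zero (Set.toFinite _)).1 hn
    subst hG
    have := numClasses_eq_card (r := (⊥ : SimpleGraph V).Adj) (by simp)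
    simp [this]
  | succ n ih =>
    obtain ⟨e, he⟩ : G.edgeSet.Nonempty := by
      rw [← Set.ncard_pos (Set.toFinite _)]; omega
    induction e using Sym2.ind with
    | _ x y =>
    rw [mem_edgeSet] at he
    set H := G.deleteEdges {s(x, y)} with hH
    have hHn : H.edgeSet.ncard = n := by
      have := Set.ncard_sdiff_singleton_add_one (s := G.edgeSet) (a := s(x, y)) he (Set.toFinite _)
      rw [hH, edgeSet_deleteEdges]
      omega
    have hHG : ∀ a b, H.Adj a b → G.Adj a b := fun a b h => G.deleteEdges_le _ h
    have hGH : ∀ a b, G.Adj a b → H.Adj a b ∨ s(a, b) = s(x, y) := fun a b h => by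
      by_cases hab : s(a, b) = s(x, y)
      · exact .inr hab
      · exact .inl (by simp [hH, deleteEdges_adj, h, -Sym2.eq, hab])
    obtain ⟨ih₁, ih₂⟩ := ih H hHn
    by_cases hr : H.Reachable x y
    · have hc : numClasses G.Adj = numClasses H.Adj := by
        refine numClasses_eq_of_eqvGen hHG fun a b hab => ?_
        rw [eqvGen_adj_iff]
        rcases hGH a b hab with h | h
        · exact h.reachable
        · rcases Sym2.eq_iff.1 h with ⟨rfl, rfl⟩ | ⟨rfl, rfl⟩
          exacts [hr, hr.symm]
      have hna : ¬ G.IsAcyclic := fun hG => by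
        have := isAcyclic_iff_forall_adj_isBridge.1 hG he
        rw [isBridge_iff] at this
        exact this hr
      refine ⟨by omega, iff_of_false hna (by omega)⟩
    · have hc : numClasses H.Adj = numClasses G.Adj + 1 := by
        -- Adjacency is symmetric, whereas `numClasses_eq_add_one` adds a single ordered pair; both
        -- relations generate the same classes.
        have hs : numClasses G.Adj = numClasses fun a b => H.Adj a b ∨ (a = x ∧ b = y) := by
          refine numClasses_eq_of_eqvGen ?_ fun a b hab => ?_
          · rintro a b (h | ⟨rfl, rfl⟩)
            exacts [hHG _ _ h, he]
          · rcases hGH a b hab with h | h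
            · exact .rel _ _ (.inl h)
            · rcases Sym2.eq_iff.1 h with ⟨rfl, rfl⟩ | ⟨rfl, rfl⟩
              exacts [.rel _ _ (.inr ⟨rfl, rfl⟩), .symm _ _ (.rel _ _ (.inr ⟨rfl, rfl⟩))]
        rw [hs]
        exact numClasses_eq_add_one (fun _ _ => .inl) (.inr ⟨rfl, rfl⟩)
          (fun h => hr (eqvGen_adj_iff.1 h)) fun _ _ h => h
      have hGeq : G = H ⊔ edge x y := by
        ext a b
        rw [sup_adj, edge_adj]
        constructor
        · intro h
          refine (hGH a b h).imp_right fun h' => ⟨?_, h.ne⟩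
          simpa using h'
        · rintro (h | ⟨⟨rfl, rfl⟩ | ⟨rfl, rfl⟩, -⟩)
          exacts [hHG _ _ h, he, he.symm]
      have hac : G.IsAcyclic ↔ H.IsAcyclic := by
        conv_lhs => rw [hGeq]
        exact isAcyclic_add_edge_iff_of_not_reachable x y hr
      exact ⟨by omega, by rw [hac, ih₂]; omega⟩

end SimpleGraph

-- From switching graphs to sets of live arcs

namespace MELL

namespace Ground

variable {G : Ground}

/-- Two nodes are linked when an arc of `L` goes from the former to the latter. -/
def Link (G : Ground) (L : Set G.Arc) (u v : G.Node) : Prop :=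
  ∃ a ∈ L, G.tail a = u ∧ G.head a = some v

/-- The sets of the arcs that are not pending in some switching graph. -/
structure IsLive (G : Ground) (L : Set G.Arc) : Prop where
  head_ne : ∀ a ∈ L, G.head a ≠ none
  mem : ∀ a v, G.head a = some v → ¬ (G.label v = .par ∨ G.label v = .con) → a ∈ L
  existsUnique : ∀ v, (G.label v = .par ∨ G.label v = .con) → ∃! a, G.head a = some v ∧ a ∈ L

/-- Every switching graph is acyclic and has one component more than there are `⊥` and `?w` nodes,
in terms of nodes and arcs only. -/
def Correct (G : Ground) : Prop :=
  ∀ L, G.IsLive L → numClasses (G.Link L) = G.numW + 1 ∧ Nat.card G.Node = L.ncard + G.numW + 1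

/-- Each arc merges at most two classes. This half of the forest count holds for every structure; it
later supplies the missing inequality when structures are joined or split. -/
theorem card_node_le (G : Ground) [Finite G.Node] [Finite G.Arc] (L : Set G.Arc)
    (hL : ∀ a ∈ L, G.head a ≠ none) : Nat.card G.Node ≤ L.ncard + numClasses (G.Link L) := by
  induction L, L.toFinite using Set.Finite.induction_on with
  | empty =>
    rw [numClasses_eq_card fun _ _ ⟨_, h, _⟩ => h]
    simp
  | @insert a L ha hfin ih =>
    rw [Set.ncard_insert_of_notMem ha hfin]
    obtain ⟨v, hv⟩ := Option.ne_none_iff_exists'.1 (hL a (Set.mem_insert _ _))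
    have := numClasses_le_add_one (r := G.Link L) (s := G.Link (insert a L)) (G.tail a) v (by
      rintro u w ⟨b, rfl | hb, rfl, h⟩
      · exact .inr ⟨rfl, by simpa [hv] using h.symm⟩
      · exact .inl ⟨b, hb, rfl, h⟩)
    have := ih fun b hb => hL b (Set.mem_insert_of_mem _ hb)
    omega

namespace Switching

/-- The arcs that are not pending. -/
def live (φ : G.Switching) : Set G.Arc := {a | ¬ φ.Pending a}

theorem isLive_live (φ : G.Switching) : G.IsLive φ.live where
  head_ne a ha h := ha (.inl h)
  mem a v hv hl := by
    rintro (h | ⟨w, hw, -⟩)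
    · simp [hv] at h
    · obtain rfl : v = w.1 := by simpa [hv] using hw
      exact hl w.2
  existsUnique v hv := by
    refine ⟨(φ ⟨v, hv⟩).1, ⟨(φ ⟨v, hv⟩).2, ?_⟩, fun a ⟨ha, hl⟩ => ?_⟩
    · rintro (h | ⟨w, hw, hne⟩)
      · simp [(φ ⟨v, hv⟩).2] at h
      · obtain rfl : ⟨v, hv⟩ = w := by
          ext; simpa [(φ ⟨v, hv⟩).2] using hw
        exact hne rfl
    · by_contra hne
      exact hl (.inr ⟨⟨v, hv⟩, ha, fun h => hne h.symm⟩)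

/-- The switching selects at each `⅋` or `?c` node its unique premise in `L`. Together with
`isLive_live`, quantifying over switchings amounts to quantifying over live sets. -/
theorem exists_live_eq {L : Set G.Arc} (hL : G.IsLive L) : ∃ φ : G.Switching, φ.live = L := by
  choose c hc using fun v : {v : G.Node // G.label v = .par ∨ G.label v = .con} =>
    hL.existsUnique v.1 v.2
  refine ⟨fun v => ⟨c v, (hc v).1.1⟩, ?_⟩
  ext a
  constructor
  · intro ha
    by_contra haL
    refine ha ?_
    by_cases h : G.head a = none
    · exact .inl h
    · obtain ⟨v, hv⟩ := Option.ne_none_iff_exists'.1 h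
      by_cases hl : G.label v = .par ∨ G.label v = .con
      · refine .inr ⟨⟨v, hl⟩, hv, ?_⟩
        rintro rfl
        exact haL (hc ⟨v, hl⟩).1.2
      · exact (haL (hL.mem a v hv hl)).elim
  · rintro ha (h | ⟨v, hv, hne⟩)
    · exact hL.head_ne a ha h
    · exact hne ((hc v).2 a ⟨hv, ha⟩).symm

theorem adj_iff (φ : G.Switching) (x y : φ.Vertex ⊕ G.Arc) :
    φ.graph.Adj x y ↔
      (∃ u a, x = .inl u ∧ y = .inr a ∧ φ.Incident u a) ∨
      (∃ u a, y = .inl u ∧ x = .inr a ∧ φ.Incident u a) := by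
  rw [graph, SimpleGraph.fromRel_adj]
  constructor
  · exact fun h => h.2
  · refine fun h => ⟨?_, h⟩
    rcases h with ⟨u, a, rfl, rfl, -⟩ | ⟨u, a, rfl, rfl, -⟩ <;> simp

/-- Sending an arc, or the fresh `•` vertex of a pending arc, to the tail of the arc retracts the
incidence graph onto the nodes. What remains of an arc is a link between its two ends when it is
live, and nothing when it is pending. -/
theorem numClasses_adj (φ : G.Switching) : numClasses φ.graph.Adj = numClasses (G.Link φ.live) := by
  let t : φ.Vertex ⊕ G.Arc → G.Node := Sum.elim (Sum.elim id fun b => G.tail b.1) G.tail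
  have ht : ∀ u a, φ.Incident u a →
      Quot.mk (G.Link φ.live) (t (.inl u)) = Quot.mk (G.Link φ.live) (t (.inr a)) := by
    rintro (v | b) a h
    · rcases h with h | ⟨h, hp⟩
      · exact congrArg _ h.symm
      · exact (Quot.sound ⟨a, hp, rfl, h⟩).symm
    · obtain rfl : b.1 = a := h
      rfl
  have hs : ∀ {u a}, φ.Incident u a → Quot.mk φ.graph.Adj (.inl u) = Quot.mk _ (.inr a) :=
    fun {u a} h => Quot.sound ((adj_iff φ _ _).2 (.inl ⟨u, a, rfl, rfl, h⟩))
  refine Nat.card_congr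
    { toFun := Quot.lift (fun x => Quot.mk _ (t x)) ?_
      invFun := Quot.lift (fun v => Quot.mk _ (.inl (.inl v))) ?_
      left_inv := ?_
      right_inv := ?_ }
  · intro x y h
    rcases (adj_iff φ x y).1 h with ⟨u, a, rfl, rfl, hu⟩ | ⟨u, a, rfl, rfl, hu⟩
    exacts [ht u a hu, (ht u a hu).symm]
  · rintro u v ⟨a, ha, rfl, h⟩
    exact (hs (u := .inl (G.tail a)) (.inl rfl)).trans (hs (u := .inl v) (.inr ⟨h, ha⟩)).symm
  · intro q
    induction q using Quot.ind with
    | _ x =>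
    rcases x with (v | b) | a
    · rfl
    · exact (hs (u := .inl (G.tail b.1)) (.inl rfl)).trans (hs (u := .inr b) rfl).symm
    · exact hs (u := .inl (G.tail a)) (.inl rfl)
  · intro q
    induction q using Quot.ind with | _ v => rfl

/-- Every arc has two ends: its tail, and either its head or its own `•` vertex. They are distinct
because there are no loops, so each arc contributes two edges of the incidence graph. -/
theorem ncard_edgeSet (φ : G.Switching) [Finite G.Arc] (hloop : ∀ a, G.head a ≠ some (G.tail a)) :
    φ.graph.edgeSet.ncard = 2 * Nat.card G.Arc := by
  have hother : ∀ a, ∃ u : φ.Vertex, u ≠ .inl (G.tail a) ∧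
      ∀ w, φ.Incident w a ↔ w = .inl (G.tail a) ∨ w = u := by
    intro a
    by_cases hp : φ.Pending a
    · refine ⟨.inr ⟨a, hp⟩, by simp, ?_⟩
      rintro (v | ⟨b, hb⟩)
      · simp [Incident, hp, eq_comm]
      · simp [Incident]
    · obtain ⟨v, hv⟩ := Option.ne_none_iff_exists'.1 (fun h => hp (.inl h))
      refine ⟨.inl v, ?_, ?_⟩
      · intro h
        rw [Sum.inl.injEq] at h
        exact hloop a (by rw [hv, h])
      · rintro (w | ⟨b, hb⟩)
        · simp [Incident, hp, hv, eq_comm]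
        · simp only [Incident, reduceCtorEq, or_self, iff_false]
          rintro rfl
          exact hp hb
  choose o ho hinc using hother
  -- The first copy of an arc names its edge to the tail, the second its edge to the other end `o
  -- a`.
  let f : G.Arc ⊕ G.Arc → Sym2 (φ.Vertex ⊕ G.Arc) :=
    Sum.elim (fun a => s(.inl (.inl (G.tail a)), .inr a)) (fun a => s(.inl (o a), .inr a))
  have hf : Function.Injective f := by
    rintro (a | a) (b | b) h
    · simp only [f, Sum.elim_inl, Sym2.eq_iff] at h
      simp_all
    · simp only [f, Sum.elim_inl, Sum.elim_inr, Sym2.eq_iff] at h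
      rcases h with ⟨h₁, h₂⟩ | ⟨h₁, h₂⟩
      · obtain rfl := Sum.inr_injective h₂
        exact (ho a (Sum.inl_injective h₁).symm).elim
      · simp at h₁
    · simp only [f, Sum.elim_inl, Sum.elim_inr, Sym2.eq_iff] at h
      rcases h with ⟨h₁, h₂⟩ | ⟨h₁, h₂⟩
      · obtain rfl := Sum.inr_injective h₂
        exact (ho a (Sum.inl_injective h₁)).elim
      · simp at h₁
    · simp only [f, Sum.elim_inr, Sym2.eq_iff] at h
      simp_all
  have hr : Set.range f = φ.graph.edgeSet := by
    ext e
    induction e using Sym2.ind with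
    | _ x y =>
    rw [SimpleGraph.mem_edgeSet, adj_iff]
    constructor
    · rintro ⟨a | a, h⟩ <;> rcases Sym2.eq_iff.1 h with ⟨rfl, rfl⟩ | ⟨rfl, rfl⟩
      · exact .inl ⟨_, _, rfl, rfl, .inl rfl⟩
      · exact .inr ⟨_, _, rfl, rfl, .inl rfl⟩
      · exact .inl ⟨_, _, rfl, rfl, (hinc _ _).2 (.inr rfl)⟩
      · exact .inr ⟨_, _, rfl, rfl, (hinc _ _).2 (.inr rfl)⟩
    · have key : ∀ u a, φ.Incident u a →
          s(Sum.inl u, Sum.inr a) ∈ Set.range f := by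
        intro u a h
        rcases (hinc a u).1 h with rfl | rfl
        exacts [⟨.inl a, rfl⟩, ⟨.inr a, rfl⟩]
      rintro (⟨u, a, rfl, rfl, h⟩ | ⟨u, a, rfl, rfl, h⟩)
      · exact key u a h
      · rw [Sym2.eq_swap]
        exact key u a h
  rw [← hr, ← Set.image_univ, Set.ncard_image_of_injective _ hf, Set.ncard_univ, Nat.card_sum]
  omega

/-- The incidence graph has `|nodes| + |pending| + |arcs|` vertices and `2 |arcs|` edges. Since
`|arcs| = |pending| + |live|`, the forest equation simplifies to one on nodes and live arcs. -/
theorem isAcyclic_graph_iff (φ : G.Switching) [Finite G.Node] [Finite G.Arc]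
    (hloop : ∀ a, G.head a ≠ some (G.tail a)) :
    φ.graph.IsAcyclic ↔ Nat.card G.Node = φ.live.ncard + numClasses (G.Link φ.live) := by
  rw [(SimpleGraph.card_le_and_isAcyclic_iff _ φ.graph (φ.ncard_edgeSet hloop)).2, numClasses_adj]
  have h := Set.ncard_add_ncard_compl φ.live
  have h' : (φ.live)ᶜ.ncard = Nat.card {a : G.Arc // φ.Pending a} := by
    rw [← Nat.card_coe_set_eq]
    exact Nat.card_congr (Equiv.subtypeEquivRight fun a => by simp [live])
  rw [Nat.card_sum, Nat.card_sum]
  omega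

end Switching

theorem correct_iff [Finite G.Node] [Finite G.Arc] (hloop : ∀ a, G.head a ≠ some (G.tail a)) :
    G.Correct ↔ (∀ φ : G.Switching, φ.graph.IsAcyclic) ∧
      ∀ φ : G.Switching, Nat.card φ.graph.ConnectedComponent = G.numW + 1 := by
  simp only [SimpleGraph.card_connectedComponent_eq, Switching.numClasses_adj,
    Switching.isAcyclic_graph_iff _ hloop]
  constructor
  · intro h
    have h₁ := fun φ : G.Switching => h _ φ.isLive_live
    refine ⟨fun φ => ?_, fun φ => (h₁ φ).1⟩
    have := h₁ φ
    omega
  · rintro ⟨h₁, h₂⟩ L hL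
    obtain ⟨φ, rfl⟩ := Switching.exists_live_eq hL
    have := h₁ φ
    have := h₂ φ
    omega

end Ground

end MELL

-- Effect of one new point on the number of classes

section Counting

variable {α β : Type*}

theorem numClasses_sum_attach {r : α → α → Prop} {s : α ⊕ Unit → α ⊕ Unit → Prop} (x : α)
    (h₁ : ∀ a b, s (.inl a) (.inl b) ↔ r a b) (h₂ : ∀ a u, s (.inl a) (.inr u) ↔ a = x)
    (h₃ : ∀ u y, ¬ s (.inr u) y) : numClasses s = numClasses r :=
  Nat.card_congr
    { toFun := Quot.lift (Sum.elim (Quot.mk r) fun _ => Quot.mk r x) (by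
        rintro (a | u) (b | v) h
        · exact Quot.sound ((h₁ a b).1 h)
        · exact congrArg (Quot.mk r) ((h₂ a v).1 h)
        · exact (h₃ _ _ h).elim
        · exact (h₃ _ _ h).elim)
      invFun := Quot.map .inl fun a b h => (h₁ a b).2 h
      left_inv := fun q => by
        induction q using Quot.ind with
        | _ a =>
        rcases a with a | u
        exacts [rfl, Quot.sound ((h₂ x u).2 rfl)]
      right_inv := fun q => by induction q using Quot.ind with | _ a => rfl }

theorem numClasses_sum_isolated [Finite α] {r : α → α → Prop} {s : α ⊕ Unit → α ⊕ Unit → Prop}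
    (h₁ : ∀ a b, s (.inl a) (.inl b) ↔ r a b) (h₂ : ∀ a u, ¬ s (.inl a) (.inr u))
    (h₃ : ∀ u y, ¬ s (.inr u) y) : numClasses s = numClasses r + 1 := by
  rw [← Nat.card_unique (α := Unit), numClasses, numClasses, ← Nat.card_sum]
  exact Nat.card_congr
    { toFun := Quot.lift (Sum.map (Quot.mk r) id) (by
        rintro (a | u) (b | v) h
        · exact congrArg Sum.inl (Quot.sound ((h₁ a b).1 h))
        · exact (h₂ _ _ h).elim
        · exact (h₃ _ _ h).elim
        · exact (h₃ _ _ h).elim)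
      invFun := Sum.elim (Quot.map .inl fun a b h => (h₁ a b).2 h) fun u => Quot.mk _ (.inr u)
      left_inv := fun q => by
        induction q using Quot.ind with
        | _ a =>
        rcases a with a | u <;> rfl
      right_inv := fun q => by
        rcases q with q | u
        · induction q using Quot.ind with | _ a => rfl
        · rfl }

/-- The new point falls in the class of `x`, so the classes of the two parts cover everything, and
those of `x` and `y` become equal. The strict bound is enough: the converse inequality will come
from `card_node_le`. -/
theorem numClasses_sum_join_lt [Finite α] [Finite β] {r : α → α → Prop} {r' : β → β → Prop}
    {s : (α ⊕ β) ⊕ Unit → (α ⊕ β) ⊕ Unit → Prop} (x : α) (y : β)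
    (h₁ : ∀ a b, r a b → s (.inl (.inl a)) (.inl (.inl b)))
    (h₂ : ∀ a b, r' a b → s (.inl (.inr a)) (.inl (.inr b)))
    (hx : s (.inl (.inl x)) (.inr ())) (hy : s (.inl (.inr y)) (.inr ())) :
    numClasses s < numClasses r + numClasses r' := by
  let f : Quot r ⊕ Quot r' → Quot s :=
    Sum.elim (Quot.map (fun a => .inl (.inl a)) h₁) (Quot.map (fun a => .inl (.inr a)) h₂)
  have hf : Function.Surjective f := fun q => by
    induction q using Quot.ind with
    | _ a =>
    rcases a with (a | a) | ⟨⟩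
    exacts [⟨.inl (Quot.mk _ a), rfl⟩, ⟨.inr (Quot.mk _ a), rfl⟩,
      ⟨.inl (Quot.mk _ x), Quot.sound hx⟩]
  have hninj : ¬ Function.Injective f := fun h => by
    have := h (a₁ := .inl (Quot.mk _ x)) (a₂ := .inr (Quot.mk _ y))
      ((Quot.sound hx).trans (Quot.sound hy).symm)
    simp at this
  rw [numClasses, numClasses, numClasses, ← Nat.card_sum]
  refine lt_of_le_of_ne (Nat.card_le_card_of_surjective f hf) fun h => hninj ?_
  exact ((Nat.bijective_iff_surjective_and_card f).2 ⟨hf, h.symm⟩).1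

end Counting

-- Correctness when a node is added

namespace MELL

namespace Ground

/-- Correctness sees only labels, tails and heads. It is therefore also insensitive to types and to
the listing of the conclusions, which serves below with identity bijections. -/
theorem Correct.of_equiv {G H : Ground} (e : G.Node ≃ H.Node) (f : G.Arc ≃ H.Arc)
    (hlabel : ∀ v, H.label (e v) = G.label v) (htail : ∀ a, H.tail (f a) = e (G.tail a))
    (hhead : ∀ a, H.head (f a) = (G.head a).map e) (hG : G.Correct) : H.Correct := by
  have hhead' : ∀ a v, H.head (f a) = some (e v) ↔ G.head a = some v := fun a v => by
    rw [hhead]; cases G.head a <;> simp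
  intro L hL
  have hL' : G.IsLive (f ⁻¹' L) := by
    refine ⟨fun a ha h => hL.head_ne _ ha (by rw [hhead, h]; rfl), fun a v hv hl => ?_,
      fun v hv => ?_⟩
    · exact hL.mem (f a) (e v) ((hhead' a v).2 hv) (by rwa [hlabel])
    · obtain ⟨b, ⟨hb, hbL⟩, hu⟩ := hL.existsUnique (e v) (by rwa [hlabel])
      obtain ⟨a, rfl⟩ := f.surjective b
      exact ⟨a, ⟨(hhead' a v).1 hb, hbL⟩, fun a' ⟨h, h'⟩ =>
        f.injective (hu (f a') ⟨(hhead' a' v).2 h, h'⟩)⟩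
  have hc : numClasses (G.Link (f ⁻¹' L)) = numClasses (H.Link L) := by
    refine numClasses_congr e fun u v => ⟨?_, ?_⟩
    · rintro ⟨a, ha, rfl, h⟩
      exact ⟨f a, ha, htail a, (hhead' a v).2 h⟩
    · rintro ⟨b, hb, hu, h⟩
      obtain ⟨a, rfl⟩ := f.surjective b
      exact ⟨a, hb, e.injective (by rw [← htail, hu]), (hhead' a v).1 h⟩
  have hw : G.numW = H.numW :=
    Nat.card_congr (e.subtypeEquiv fun v => by rw [hlabel])
  have hn : (f ⁻¹' L).ncard = L.ncard := by
    rw [Set.ncard_preimage_of_injective_subset_range f.injective (by simp)]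
  have := hG _ hL'
  rwa [hc, hw, hn, Nat.card_congr e] at this

/-- `G` is finite and its list of conclusions consists of distinct conclusions. -/
structure HasConcls (G : Ground) : Prop where
  finite_node : Finite G.Node
  finite_arc : Finite G.Arc
  nodup_concls : G.concls.Nodup
  head_eq_none : ∀ a ∈ G.concls, G.head a = none

theorem HasConcls.union {G H : Ground} (hG : G.HasConcls) (hH : H.HasConcls) :
    (G.union H).HasConcls := by
  have := hG.finite_node; have := hH.finite_node
  have := hG.finite_arc; have := hH.finite_arc
  refine ⟨inferInstanceAs (Finite (_ ⊕ _)), inferInstanceAs (Finite (_ ⊕ _)), ?_, ?_⟩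
  · refine List.Nodup.append (hG.nodup_concls.map Sum.inl_injective)
      (hH.nodup_concls.map Sum.inr_injective) ?_
    intro x hx hy
    obtain ⟨a, -, rfl⟩ := List.mem_map.1 hx
    simp at hy
  · intro a ha
    rcases List.mem_append.1 ha with ha | ha <;> obtain ⟨b, hb, rfl⟩ := List.mem_map.1 ha
    · simp [hG.head_eq_none b hb]
    · simp [hH.head_eq_none b hb]

theorem HasConcls.addNode {G : Ground} (hG : G.HasConcls) (l : NodeLabel) (i k : ℕ)
    (outs : List Formula) : (G.addNode l i k outs).HasConcls := by
  have := hG.finite_node; have := hG.finite_arc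
  have hsplit : G.concls.take i ++ ((G.concls.drop i).take k ++ G.concls.drop (i + k)) =
      G.concls := by
    rw [← List.drop_drop, List.take_append_drop, List.take_append_drop]
  have hnd := hG.nodup_concls
  rw [← hsplit, List.nodup_append', List.nodup_append'] at hnd
  obtain ⟨h₁, ⟨-, h₂, h₃⟩, h₄⟩ := hnd
  refine ⟨inferInstanceAs (Finite (_ ⊕ _)), inferInstanceAs (Finite (_ ⊕ _)), ?_, ?_⟩
  · rw [List.nodup_append', List.nodup_append']
    refine ⟨⟨h₁.map Sum.inl_injective, (List.nodup_finRange _).map Sum.inr_injective, ?_⟩,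
      h₂.map Sum.inl_injective, ?_⟩
    · intro x hx hy
      obtain ⟨a, -, rfl⟩ := List.mem_map.1 hx
      simp at hy
    · intro x hx hy
      obtain ⟨a, ha, rfl⟩ := List.mem_map.1 hy
      have : a ∈ G.concls.take i := by simpa [← List.map_take] using hx
      exact h₄ this (List.mem_append_right _ ha)
  · intro x hx
    have key : ∀ a, a ∈ G.concls → a ∉ (G.concls.drop i).take k →
        (G.addNode l i k outs).head (.inl a) = none := fun a ha hn => by
      simp [hn, hG.head_eq_none a ha]
    rcases List.mem_append.1 hx with hx | hx
    · rcases List.mem_append.1 hx with hx | hx <;> obtain ⟨a, ha, rfl⟩ := List.mem_map.1 hx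
      · exact key a (List.mem_of_mem_take ha) fun h => h₄ ha (List.mem_append_left _ h)
      · rfl
    · obtain ⟨a, ha, rfl⟩ := List.mem_map.1 hx
      exact key a (List.mem_of_mem_drop ha) fun h => h₃ h ha

theorem addNode_types (G : Ground) (l : NodeLabel) (i k : ℕ) (outs : List Formula) :
    (G.addNode l i k outs).concls.map (G.addNode l i k outs).type =
      (G.concls.map G.type).take i ++ outs ++ (G.concls.map G.type).drop (i + k) := by
  simp [Function.comp_def, List.map_take, List.map_drop]

theorem union_types (G H : Ground) :
    (G.union H).concls.map (G.union H).type = G.concls.map G.type ++ H.concls.map H.type := by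
  simp [Function.comp_def]

theorem numW_addNode (G : Ground) [Finite G.Node] (l : NodeLabel) (i k : ℕ)
    (outs : List Formula) : (G.addNode l i k outs).numW =
      G.numW + Nat.card {_u : Unit // l = .bot ∨ l = .weak} := by
  rw [numW, numW, ← Nat.card_sum]
  exact Nat.card_congr (Equiv.subtypeSum (p := fun v : G.Node ⊕ Unit =>
    Sum.elim G.label (fun _ => l) v = .bot ∨ Sum.elim G.label (fun _ => l) v = .weak))

theorem numW_addNode_of_not (G : Ground) [Finite G.Node] {l : NodeLabel} (i k : ℕ)
    (outs : List Formula) (hl : ¬ (l = .bot ∨ l = .weak)) :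
    (G.addNode l i k outs).numW = G.numW := by
  simp [numW_addNode, hl]

theorem numW_addNode_of (G : Ground) [Finite G.Node] {l : NodeLabel} (i k : ℕ)
    (outs : List Formula) (hl : l = .bot ∨ l = .weak) :
    (G.addNode l i k outs).numW = G.numW + 1 := by
  simp [numW_addNode, hl]

theorem numW_union (G H : Ground) [Finite G.Node] [Finite H.Node] :
    (G.union H).numW = G.numW + H.numW := by
  rw [numW, numW, numW, ← Nat.card_sum]
  exact Nat.card_congr (Equiv.subtypeSum (p := fun v : G.Node ⊕ H.Node =>
    Sum.elim G.label H.label v = .bot ∨ Sum.elim G.label H.label v = .weak))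

/-- `S` is a possible set of non-pending arcs among the premises `T` of a node labelled by `l`. -/
structure Selects {A : Type} (l : NodeLabel) (T : List A) (S : Set A) : Prop where
  subset : ∀ a ∈ S, a ∈ T
  mem : ¬ (l = .par ∨ l = .con) → ∀ a ∈ T, a ∈ S
  existsUnique : (l = .par ∨ l = .con) → ∃! a, a ∈ S

/-- The premises of the new node were conclusions of `G`, hence not live there, and its own
conclusions have no head. So a live set after the addition is a live set before it together with an
independent selection among the new premises; `IsLive.exists_of_addNode` is the converse. -/
theorem isLive_addNode {G : Ground} (hG : G.HasConcls) {l : NodeLabel} {i k : ℕ}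
    {outs : List Formula} {L S : Set G.Arc} (hL : G.IsLive L)
    (hS : Selects l ((G.concls.drop i).take k) S) :
    (G.addNode l i k outs).IsLive (Sum.inl '' (L ∪ S)) := by
  have hT : ∀ a ∈ (G.concls.drop i).take k, G.head a = none := fun a ha =>
    hG.head_eq_none a (List.mem_of_mem_drop (List.mem_of_mem_take ha))
  have hLT : ∀ a ∈ L, a ∉ (G.concls.drop i).take k := fun a ha h => hL.head_ne a ha (hT a h)
  refine ⟨?_, ?_, ?_⟩
  · rintro _ ⟨a, ha | ha, rfl⟩
    · simpa [hLT a ha] using hL.head_ne a ha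
    · simp [hS.subset a ha]
  · rintro (a | a) (v | v) hv hl
    · refine ⟨a, .inl (hL.mem a v ?_ hl), rfl⟩
      by_cases ha : a ∈ (G.concls.drop i).take k
      · simp [ha] at hv
      · simpa [ha] using hv
    · refine ⟨a, .inr (hS.mem hl a ?_), rfl⟩
      by_contra ha
      simp [ha] at hv
    · simp at hv
    · simp at hv
  · rintro (v | v) hv
    · obtain ⟨a, ⟨ha, haL⟩, hu⟩ := hL.existsUnique v hv
      refine ⟨.inl a, ⟨by simp [hLT a haL, ha], a, .inl haL, rfl⟩, ?_⟩
      rintro _ ⟨hb, b, hbL | hbS, rfl⟩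
      · rw [hu b ⟨by simpa [hLT b hbL] using hb, hbL⟩]
      · simp [hS.subset b hbS] at hb
    · obtain ⟨a, ha, hu⟩ := hS.existsUnique hv
      refine ⟨.inl a, ⟨by simp [hS.subset a ha], a, .inr ha, rfl⟩, ?_⟩
      rintro _ ⟨hb, b, hbL | hbS, rfl⟩
      · simp [hLT b hbL] at hb
      · rw [hu b hbS]

theorem IsLive.exists_of_addNode {G : Ground} {l : NodeLabel} {i k : ℕ}
    {outs : List Formula} (hG : G.HasConcls) {L' : Set (G.addNode l i k outs).Arc}
    (h : (G.addNode l i k outs).IsLive L') :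
    ∃ L S, G.IsLive L ∧ Selects l ((G.concls.drop i).take k) S ∧ L' = Sum.inl '' (L ∪ S) := by
  have hT : ∀ a ∈ (G.concls.drop i).take k, G.head a = none := fun a ha =>
    hG.head_eq_none a (List.mem_of_mem_drop (List.mem_of_mem_take ha))
  have hTn : ∀ a v, G.head a = some v → a ∉ (G.concls.drop i).take k := fun a v hv ha => by
    simp [hT a ha] at hv
  refine ⟨{a | .inl a ∈ L' ∧ a ∉ (G.concls.drop i).take k},
    {a | .inl a ∈ L' ∧ a ∈ (G.concls.drop i).take k}, ⟨?_, ?_, ?_⟩, ⟨?_, ?_, ?_⟩, ?_⟩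
  · rintro a ⟨ha, haT⟩
    simpa [haT] using h.head_ne _ ha
  · intro a v hv hl
    exact ⟨h.mem (.inl a) (.inl v) (by simp [hTn a v hv, hv]) hl, hTn a v hv⟩
  · intro v hv
    obtain ⟨a | a, ⟨ha, haL⟩, hu⟩ := h.existsUnique (.inl v) hv
    · by_cases haT : a ∈ (G.concls.drop i).take k
      · simp [haT] at ha
      · refine ⟨a, ⟨by simpa [haT] using ha, haL, haT⟩, fun b ⟨hb, hbL, hbT⟩ => ?_⟩
        exact Sum.inl_injective (hu (.inl b) ⟨by simp [hbT, hb], hbL⟩)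
    · simp at ha
  · exact fun a ha => ha.2
  · exact fun hl a ha => ⟨h.mem (.inl a) (.inr ()) (by simp [ha]) hl, ha⟩
  · intro hl
    obtain ⟨a | a, ⟨ha, haL⟩, hu⟩ := h.existsUnique (.inr ()) hl
    · by_cases haT : a ∈ (G.concls.drop i).take k
      · refine ⟨a, ⟨haL, haT⟩, fun b ⟨hbL, hbT⟩ => ?_⟩
        exact Sum.inl_injective (hu (.inl b) ⟨by simp [hbT], hbL⟩)
      · simp [haT] at ha
    · simp at ha
  · ext (a | a)
    · by_cases haT : a ∈ (G.concls.drop i).take k <;> simp [haT]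
    · simpa using fun ha : Sum.inr a ∈ L' => h.head_ne _ ha rfl

section Link

variable {G : Ground} {l : NodeLabel} {i k : ℕ} {outs : List Formula} {L S : Set G.Arc}

theorem link_addNode_inl_inl (hL : G.IsLive L) (hG : G.HasConcls)
    (hS : Selects l ((G.concls.drop i).take k) S) (u v : G.Node) :
    (G.addNode l i k outs).Link (Sum.inl '' (L ∪ S)) (.inl u) (.inl v) ↔ G.Link L u v := by
  have hLT : ∀ a ∈ L, a ∉ (G.concls.drop i).take k := fun a ha h =>
    hL.head_ne a ha (hG.head_eq_none a (List.mem_of_mem_drop (List.mem_of_mem_take h)))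
  constructor
  · rintro ⟨_, ⟨a, ha | ha, rfl⟩, ht, hh⟩
    · exact ⟨a, ha, by simpa using ht, by simpa [hLT a ha] using hh⟩
    · simp [hS.subset a ha] at hh
  · rintro ⟨a, ha, rfl, hh⟩
    exact ⟨.inl a, ⟨a, .inl ha, rfl⟩, rfl, by simp [hLT a ha, hh]⟩

theorem link_addNode_inl_inr (hL : G.IsLive L) (hG : G.HasConcls)
    (hS : Selects l ((G.concls.drop i).take k) S) (u : G.Node) (v : Unit) :
    (G.addNode l i k outs).Link (Sum.inl '' (L ∪ S)) (.inl u) (.inr v) ↔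
      ∃ a ∈ S, G.tail a = u := by
  have hLT : ∀ a ∈ L, a ∉ (G.concls.drop i).take k := fun a ha h =>
    hL.head_ne a ha (hG.head_eq_none a (List.mem_of_mem_drop (List.mem_of_mem_take h)))
  constructor
  · rintro ⟨_, ⟨a, ha | ha, rfl⟩, ht, hh⟩
    · simp [hLT a ha] at hh
    · exact ⟨a, ha, by simpa using ht⟩
  · rintro ⟨a, ha, rfl⟩
    exact ⟨.inl a, ⟨a, .inr ha, rfl⟩, rfl, by simp [hS.subset a ha]⟩

theorem not_link_addNode_inr (u : Unit) (y : G.Node ⊕ Unit) :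
    ¬ (G.addNode l i k outs).Link (Sum.inl '' (L ∪ S)) (.inr u) y := by
  rintro ⟨_, ⟨a, -, rfl⟩, ht, -⟩
  simp at ht

theorem ncard_addNode (hL : G.IsLive L) (hG : G.HasConcls)
    (hS : Selects l ((G.concls.drop i).take k) S) :
    (Sum.inl '' (L ∪ S) : Set (G.addNode l i k outs).Arc).ncard = L.ncard + S.ncard := by
  have := hG.finite_arc
  rw [Set.ncard_image_of_injective _ Sum.inl_injective]
  refine Set.ncard_union_eq (Set.disjoint_left.2 fun a ha hS' => ?_) (Set.toFinite _)
    (Set.toFinite _)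
  exact hL.head_ne a ha (hG.head_eq_none a
    (List.mem_of_mem_drop (List.mem_of_mem_take (hS.subset a hS'))))

end Link

theorem card_node_addNode (G : Ground) [Finite G.Node] (l : NodeLabel) (i k : ℕ)
    (outs : List Formula) : Nat.card (G.addNode l i k outs).Node = Nat.card G.Node + 1 := by
  rw [← Nat.card_unique (α := Unit), ← Nat.card_sum]

/-- Adding a node of which exactly one premise is not pending. -/
theorem correct_addNode_attach {G : Ground} (hG : G.HasConcls) {l : NodeLabel} {i k : ℕ}
    {outs : List Formula} (hl : ¬ (l = .bot ∨ l = .weak))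
    (hex : ∃ S, Selects l ((G.concls.drop i).take k) S)
    (hone : ∀ S, Selects l ((G.concls.drop i).take k) S → ∃ a, S = {a}) :
    (G.addNode l i k outs).Correct ↔ G.Correct := by
  have := hG.finite_node
  have hw := G.numW_addNode_of_not i k outs hl
  have hc := G.card_node_addNode l i k outs
  have key : ∀ L S, G.IsLive L → Selects l ((G.concls.drop i).take k) S →
      numClasses ((G.addNode l i k outs).Link (Sum.inl '' (L ∪ S))) = numClasses (G.Link L) ∧
      (Sum.inl '' (L ∪ S) : Set (G.addNode l i k outs).Arc).ncard = L.ncard + 1 := by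
    intro L S hL hS
    obtain ⟨a, rfl⟩ := hone S hS
    refine ⟨numClasses_sum_attach (G.tail a) (link_addNode_inl_inl hL hG hS) (fun u v => ?_)
      not_link_addNode_inr, ?_⟩
    · rw [link_addNode_inl_inr hL hG hS]
      simp [eq_comm]
    · rw [ncard_addNode hL hG hS, Set.ncard_singleton]
  constructor
  · intro h L hL
    obtain ⟨S, hS⟩ := hex
    have h₁ := h _ (isLive_addNode (outs := outs) hG hL hS)
    rw [(key L S hL hS).1, (key L S hL hS).2] at h₁
    omega
  · intro h L' hL'
    obtain ⟨L, S, hL, hS, rfl⟩ := hL'.exists_of_addNode hG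
    have := h L hL
    rw [(key L S hL hS).1, (key L S hL hS).2]
    omega

theorem correct_addNode_der {G : Ground} (hG : G.HasConcls) {i : ℕ} {outs : List Formula}
    {a : G.Arc} (ha : (G.concls.drop i).take 1 = [a]) :
    (G.addNode .der i 1 outs).Correct ↔ G.Correct := by
  refine correct_addNode_attach hG (by simp) ⟨{a}, ?_⟩ fun S hS => ⟨a, ?_⟩
  · rw [ha]
    exact ⟨by simp, by simp, by simp⟩
  · rw [ha] at hS
    ext b
    exact ⟨fun hb => by simpa using hS.subset b hb, fun hb => hS.mem (by simp) b (by simpa using hb)⟩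

theorem correct_addNode_par_con {G : Ground} (hG : G.HasConcls) {l : NodeLabel} {i k : ℕ}
    {outs : List Formula} (hl : l = .par ∨ l = .con) {a : G.Arc}
    (ha : a ∈ (G.concls.drop i).take k) :
    (G.addNode l i k outs).Correct ↔ G.Correct := by
  refine correct_addNode_attach hG (by rcases hl with rfl | rfl <;> simp) ⟨{a}, ?_⟩ fun S hS => ?_
  · exact ⟨by simpa using ha, fun h => (h hl).elim, fun _ => ⟨a, by simp⟩⟩
  · obtain ⟨b, hb, hu⟩ := hS.existsUnique hl
    exact ⟨b, Set.eq_singleton_iff_unique_mem.2 ⟨hb, hu⟩⟩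

/-- Nothing can be selected from an empty list of premises, so the new node is isolated. -/
theorem numClasses_addNode_zero {G : Ground} (hG : G.HasConcls) {l : NodeLabel} {i : ℕ}
    {outs : List Formula} {L S : Set G.Arc} (hL : G.IsLive L)
    (hS : Selects l ((G.concls.drop i).take 0) S) :
    numClasses ((G.addNode l i 0 outs).Link (Sum.inl '' (L ∪ S))) = numClasses (G.Link L) + 1 ∧
      (Sum.inl '' (L ∪ S) : Set (G.addNode l i 0 outs).Arc).ncard = L.ncard := by
  have := hG.finite_node
  have hS0 : S = ∅ := Set.eq_empty_of_forall_notMem fun a ha => by simpa using hS.subset a ha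
  refine ⟨numClasses_sum_isolated (link_addNode_inl_inl hL hG hS) (fun u v => ?_)
      not_link_addNode_inr, ?_⟩
  · rw [link_addNode_inl_inr hL hG hS]
    simp [hS0]
  · rw [ncard_addNode hL hG hS, hS0, Set.ncard_empty, add_zero]

/-- The new component, the new node and the increment of `numW` compensate each other in both
equations. -/
theorem correct_addNode_bot_weak {G : Ground} (hG : G.HasConcls) {l : NodeLabel} {i : ℕ}
    {outs : List Formula} (hl : l = .bot ∨ l = .weak) :
    (G.addNode l i 0 outs).Correct ↔ G.Correct := by
  have := hG.finite_node
  have hw := G.numW_addNode_of i 0 outs hl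
  have hc := G.card_node_addNode l i 0 outs
  constructor
  · intro h L hL
    have hS : Selects l ((G.concls.drop i).take 0) ∅ :=
      ⟨by simp, by simp, by rcases hl with rfl | rfl <;> simp⟩
    have h₁ := h _ (isLive_addNode (outs := outs) hG hL hS)
    have h₂ := numClasses_addNode_zero (outs := outs) hG hL hS
    rw [h₂.1, h₂.2] at h₁
    omega
  · intro h L' hL'
    obtain ⟨L, S, hL, hS, rfl⟩ := hL'.exists_of_addNode hG
    have := h L hL
    have h₂ := numClasses_addNode_zero (outs := outs) hG hL hS
    rw [h₂.1, h₂.2]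
    omega

/-- This is the base case of `ax`, `1` and boxes: one node, one class, no live arc and `numW = 0`.
-/
theorem correct_addNode_of_isEmpty {G : Ground} (hG : G.HasConcls) [IsEmpty G.Node]
    {l : NodeLabel} {i : ℕ} {outs : List Formula} (hl : ¬ (l = .bot ∨ l = .weak)) :
    (G.addNode l i 0 outs).Correct := by
  have hw := G.numW_addNode_of_not i 0 outs hl
  have hc := G.card_node_addNode l i 0 outs
  have hn : G.numW = 0 := by simp [numW]
  intro L' hL'
  obtain ⟨L, S, hL, hS, rfl⟩ := hL'.exists_of_addNode hG
  have h₂ := numClasses_addNode_zero (outs := outs) hG hL hS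
  have hL0 : L = ∅ := Set.eq_empty_of_forall_notMem fun a => (IsEmpty.false (G.tail a)).elim
  have h0 : numClasses (G.Link L) = 0 := by
    rw [numClasses_eq_card fun u => (IsEmpty.false u).elim]; simp
  rw [h₂.1, h₂.2, hc, hw, hn, h0, hL0]
  simp

theorem IsLive.of_union {G H : Ground} {L : Set (G.union H).Arc} (h : (G.union H).IsLive L) :
    G.IsLive (Sum.inl ⁻¹' L) ∧ H.IsLive (Sum.inr ⁻¹' L) := by
  constructor
  · refine ⟨fun a ha => by simpa using h.head_ne _ ha,
      fun a v hv hl => h.mem (.inl a) (.inl v) (by simp [hv]) hl, fun v hv => ?_⟩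
    obtain ⟨a | a, ⟨ha, haL⟩, hu⟩ := h.existsUnique (.inl v) hv
    · exact ⟨a, ⟨by simpa using ha, haL⟩, fun b ⟨hb, hbL⟩ =>
        Sum.inl_injective (hu (.inl b) ⟨by simp [hb], hbL⟩)⟩
    · simp at ha
  · refine ⟨fun a ha => by simpa using h.head_ne _ ha,
      fun a v hv hl => h.mem (.inr a) (.inr v) (by simp [hv]) hl, fun v hv => ?_⟩
    obtain ⟨a | a, ⟨ha, haL⟩, hu⟩ := h.existsUnique (.inr v) hv
    · simp at ha
    · exact ⟨a, ⟨by simpa using ha, haL⟩, fun b ⟨hb, hbL⟩ =>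
        Sum.inr_injective (hu (.inr b) ⟨by simp [hb], hbL⟩)⟩

/-- Joining two correct structures by a node with one premise in each of them. -/
theorem Correct.addNode_union {G H : Ground} (hG : G.HasConcls) (hH : H.HasConcls)
    (cG : G.Correct) (cH : H.Correct) {l : NodeLabel} {i k : ℕ} {outs : List Formula}
    (hl : ¬ (l = .bot ∨ l = .weak)) (hl' : ¬ (l = .par ∨ l = .con)) {a : G.Arc} {b : H.Arc}
    (hab : ((G.union H).concls.drop i).take k = [.inl a, .inr b]) :
    ((G.union H).addNode l i k outs).Correct := by
  have := hG.finite_node; have := hH.finite_node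
  have := hG.finite_arc; have := hH.finite_arc
  have hU := hG.union hH
  have hA := hU.addNode l i k outs
  have := hU.finite_node; have := hA.finite_node; have := hA.finite_arc
  have hw := (G.union H).numW_addNode_of_not i k outs hl
  have hw' := numW_union G H
  have hc := (G.union H).card_node_addNode l i k outs
  have hc' : Nat.card (G.union H).Node = Nat.card G.Node + Nat.card H.Node := Nat.card_sum
  intro L' hL'
  have hle := card_node_le _ L' hL'.head_ne
  obtain ⟨L, S, hL, hS, rfl⟩ := hL'.exists_of_addNode hU
  have hn := ncard_addNode (outs := outs) hL hU hS
  have hS2 : S = {.inl a, .inr b} := by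
    ext x
    rw [hab] at hS
    exact ⟨fun hx => by simpa using hS.subset x hx,
      fun hx => hS.mem hl' x (by simpa using hx)⟩
  have hSn : S.ncard = 2 := by rw [hS2, Set.ncard_pair (by simp)]
  obtain ⟨h₁, h₂⟩ := hL.of_union
  have hLn : L.ncard = (Sum.inl ⁻¹' L).ncard + (Sum.inr ⁻¹' L).ncard := by
    conv_lhs => rw [← Set.image_preimage_inl_union_image_preimage_inr L]
    rw [Set.ncard_union_eq _ (Set.toFinite _) (Set.toFinite _),
      Set.ncard_image_of_injective _ Sum.inl_injective,
      Set.ncard_image_of_injective _ Sum.inr_injective]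
    rw [Set.disjoint_left]
    rintro _ ⟨x, -, rfl⟩ ⟨y, -, h⟩
    simp at h
  -- With `w` and `w'` the values of `numW` for `G` and `H`, there are at most `w + w' + 1` classes.
  -- Conversely the node count in `hle`, where the new node adds one node and two live arcs, gives
  -- at least that many.
  have hlt := numClasses_sum_join_lt (r := G.Link (Sum.inl ⁻¹' L)) (r' := H.Link (Sum.inr ⁻¹' L))
    (s := ((G.union H).addNode l i k outs).Link (Sum.inl '' (L ∪ S))) (G.tail a) (H.tail b)
    (fun u v ⟨x, hx, ht, hh⟩ => (link_addNode_inl_inl hL hU hS _ _).2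
      ⟨.inl x, hx, by simp [ht], by simp [hh]⟩)
    (fun u v ⟨x, hx, ht, hh⟩ => (link_addNode_inl_inl hL hU hS _ _).2
      ⟨.inr x, hx, by simp [ht], by simp [hh]⟩)
    ((link_addNode_inl_inr hL hU hS _ _).2 ⟨.inl a, by simp [hS2], rfl⟩)
    ((link_addNode_inl_inr hL hU hS _ _).2 ⟨.inr b, by simp [hS2], rfl⟩)
  have e₁ := cG _ h₁
  have e₂ := cH _ h₂
  omega

end Ground

-- Isomorphism, and correctness at every depth

namespace PreStructure

/-- The ground structure. -/
def ground : PreStructure → Ground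
  | .mk G _ => G

/-- The ground structure and the contents of the boxes, at every depth, are correct. -/
def Correct : PreStructure → Prop
  | .mk G content => G.Correct ∧ ∀ v, (content v).Correct

theorem Correct.of_iso {R S : PreStructure} (h : R.Iso S) (hR : R.Correct) : S.Correct := by
  induction R generalizing S with
  | mk G c ih =>
  obtain ⟨H, d⟩ := S
  obtain ⟨e, f, hl, -, ht, hh, -, -, -, hc⟩ := h
  refine ⟨hR.1.of_equiv e f hl ht hh, fun w => ?_⟩
  obtain ⟨w, hw⟩ := w
  obtain ⟨v, rfl⟩ := e.surjective w
  have hv : G.label v = .box := (hl v).symm.trans hw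
  exact ih ⟨v, hv⟩ (hc ⟨v, hv⟩) (hR.2 ⟨v, hv⟩)

theorem Iso.refl (R : PreStructure) : R.Iso R := by
  induction R with
  | mk G c ih =>
  exact ⟨.refl _, .refl _, fun _ => rfl, fun _ => rfl, fun _ => rfl, fun _ => by simp,
    fun _ _ => by simp, fun _ _ => by simp, by simp, ih⟩

theorem Iso.trans {R S T : PreStructure} (h : R.Iso S) (h' : S.Iso T) : R.Iso T := by
  induction R generalizing S T with
  | mk G c ih =>
  obtain ⟨H, d⟩ := S
  obtain ⟨K, k⟩ := T
  obtain ⟨e, f, hl, hy, ht, hh, hp, hb, hc, hi⟩ := h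
  obtain ⟨e', f', hl', hy', ht', hh', hp', hb', hc', hi'⟩ := h'
  refine ⟨e.trans e', f.trans f', fun v => (hl' _).trans (hl v), fun a => (hy' _).trans (hy a),
    fun a => by simp [ht', ht], fun a => by simp [hh', hh, Function.comp_def], fun v hv => ?_,
    fun v hv => ?_, by simp [hc', hc], fun v => ih v (hi v) (hi' _)⟩
  · simp [hp v hv, hp' (e v) (by rwa [hl])]
  · simp [hb v hv, hb' (e v) (by rwa [hl])]

theorem Iso.symm {R S : PreStructure} (h : R.Iso S) : S.Iso R := by
  induction R generalizing S with
  | mk G c ih =>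
  obtain ⟨H, d⟩ := S
  obtain ⟨e, f, hl, hy, ht, hh, hp, hb, hc, hi⟩ := h
  refine ⟨e.symm, f.symm, fun v => ?_, fun a => ?_, fun a => ?_, fun a => ?_, fun v hv => ?_,
    fun v hv => ?_, by simp [hc], fun v => ?_⟩
  · rw [← hl, e.apply_symm_apply]
  · rw [← hy, f.apply_symm_apply]
  · rw [e.eq_symm_apply, ← ht, f.apply_symm_apply]
  · conv_rhs => rw [← f.apply_symm_apply a, hh]
    simp
  · obtain ⟨v, rfl⟩ := e.surjective v
    rw [hl] at hv
    simp [hp v hv]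
  · obtain ⟨v, rfl⟩ := e.surjective v
    rw [hl] at hv
    simp [hb v hv]
  · obtain ⟨w, hw⟩ := v
    obtain ⟨v, rfl⟩ := e.surjective w
    have hv : G.label v = .box := (hl v).symm.trans hw
    have := ih ⟨v, hv⟩ (hi ⟨v, hv⟩)
    simpa using this

theorem Iso.union {R R' S S' : PreStructure} (h : R.Iso R') (h' : S.Iso S') :
    (R.union S).Iso (R'.union S') := by
  obtain ⟨G, c⟩ := R
  obtain ⟨G', c'⟩ := R'
  obtain ⟨H, d⟩ := S
  obtain ⟨H', d'⟩ := S'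
  obtain ⟨e, f, hl, hy, ht, hh, hp, hb, hc, hi⟩ := h
  obtain ⟨e', f', hl', hy', ht', hh', hp', hb', hc', hi'⟩ := h'
  refine ⟨e.sumCongr e', f.sumCongr f', ?_, ?_, ?_, ?_, ?_, ?_, ?_, ?_⟩
  · rintro (v | v)
    exacts [hl v, hl' v]
  · rintro (a | a)
    exacts [hy a, hy' a]
  · rintro (a | a)
    exacts [congrArg Sum.inl (ht a), congrArg Sum.inr (ht' a)]
  · rintro (a | a)
    · simp [hh, Function.comp_def]
    · simp [hh', Function.comp_def]
  · rintro (v | v) hv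
    · simp [hp v hv, Function.comp_def]
    · simp [hp' v hv, Function.comp_def]
  · rintro (v | v) hv
    · simp [hb v hv, Function.comp_def]
    · simp [hb' v hv, Function.comp_def]
  · simp [hc, hc', Function.comp_def]
  · rintro ⟨v | v, hv⟩
    exacts [hi ⟨v, hv⟩, hi' ⟨v, hv⟩]

theorem Iso.addNode {R S : PreStructure} (h : R.Iso S) {l : NodeLabel}
    {d d' : l = .box → PreStructure} (hd : ∀ hl, (d hl).Iso (d' hl)) (i k : ℕ)
    (outs : List Formula) : (R.addNode l d i k outs).Iso (S.addNode l d' i k outs) := by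
  obtain ⟨G, c⟩ := R
  obtain ⟨H, c'⟩ := S
  obtain ⟨e, f, hl, hy, ht, hh, hp, hb, hc, hi⟩ := h
  refine ⟨e.sumCongr (.refl _), f.sumCongr (.refl _), ?_, ?_, ?_, ?_, ?_, ?_, ?_, ?_⟩
  · rintro (v | v)
    exacts [hl v, rfl]
  · rintro (a | a)
    exacts [hy a, rfl]
  · rintro (a | a)
    exacts [congrArg Sum.inl (ht a), rfl]
  · rintro (a | a)
    · have : f a ∈ (H.concls.drop i).take k ↔ a ∈ (G.concls.drop i).take k := by
        rw [hc, ← List.map_drop, ← List.map_take]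
        exact List.mem_map_of_injective f.injective
      by_cases ha : a ∈ (G.concls.drop i).take k
      · simp [ha, this]
      · simp [ha, this, hh, Function.comp_def]
    · rfl
  · rintro (v | v) hv
    · simp [hp v hv, Function.comp_def]
    · simp [hc, Function.comp_def, List.map_drop, List.map_take]
  · rintro (v | v) hv
    · simp [hb v hv, Function.comp_def]
    · simp [Function.comp_def]
  · simp [hc, Function.comp_def, List.map_drop, List.map_take]
  · rintro ⟨v | v, hv⟩
    exacts [hi ⟨v, hv⟩, hd hv]

/-- The contents of the boxes are correct. -/
def ContentCorrect : PreStructure → Prop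
  | .mk _ content => ∀ v, (content v).Correct

theorem correct_iff (R : PreStructure) : R.Correct ↔ R.ground.Correct ∧ R.ContentCorrect := by
  cases R; rfl

theorem ContentCorrect.union {R S : PreStructure} (hR : R.ContentCorrect)
    (hS : S.ContentCorrect) : (R.union S).ContentCorrect := by
  cases R; cases S
  rintro ⟨v | v, hv⟩
  exacts [hR ⟨v, hv⟩, hS ⟨v, hv⟩]

theorem correct_addNode {R : PreStructure} {l : NodeLabel} {d : l = .box → PreStructure}
    {i k : ℕ} {outs : List Formula} (hR : R.ContentCorrect)
    (h : (R.ground.addNode l i k outs).Correct) (hd : ∀ hl, (d hl).Correct) :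
    (R.addNode l d i k outs).Correct := by
  obtain ⟨G, c⟩ := R
  refine ⟨h, ?_⟩
  rintro ⟨v | v, hv⟩
  exacts [hR ⟨v, hv⟩, hd hv]

end PreStructure

-- Soundness: desequentializations are correct

theorem Ground.hasConcls_empty : Ground.empty.HasConcls :=
  ⟨inferInstanceAs (Finite Empty), inferInstanceAs (Finite Empty), by simp, by simp⟩

theorem Ground.addNode_empty_correct {l : NodeLabel} {outs : List Formula}
    (hl : ¬ (l = .bot ∨ l = .weak)) : (Ground.empty.addNode l 0 0 outs).Correct :=
  have : IsEmpty Ground.empty.Node := inferInstanceAs (IsEmpty Empty)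
  Ground.correct_addNode_of_isEmpty Ground.hasConcls_empty hl

namespace PreStructure

theorem ground_addNode (R : PreStructure) (l : NodeLabel) (d : l = .box → PreStructure) (i k : ℕ)
    (outs : List Formula) : (R.addNode l d i k outs).ground = R.ground.addNode l i k outs := by
  cases R; rfl

theorem ground_union (R S : PreStructure) : (R.union S).ground = R.ground.union S.ground := by
  cases R; cases S; rfl

theorem conclTypes_eq (R : PreStructure) :
    R.conclTypes = R.ground.concls.map R.ground.type := by
  cases R; rfl

theorem conclTypes_addNode (R : PreStructure) (l : NodeLabel) (d : l = .box → PreStructure)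
    (i k : ℕ) (outs : List Formula) : (R.addNode l d i k outs).conclTypes =
      R.conclTypes.take i ++ outs ++ R.conclTypes.drop (i + k) := by
  cases R; exact Ground.addNode_types _ _ _ _ _

theorem conclTypes_union (R S : PreStructure) :
    (R.union S).conclTypes = R.conclTypes ++ S.conclTypes := by
  cases R; cases S; exact Ground.union_types _ _

theorem conclTypes_exchange (R : PreStructure) {Γ Δ : List Formula} {A B : Formula}
    (h : R.conclTypes = Γ ++ [A, B] ++ Δ) :
    (R.exchange Γ.length).conclTypes = Γ ++ [B, A] ++ Δ := by
  obtain ⟨G, c⟩ := R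
  simp only [conclTypes] at h
  simp [exchange, conclTypes, List.map_drop, List.map_take, h]

/-- The properties shared by the desequentializations of the proofs of `Γ`. -/
structure Sound (R : PreStructure) (Γ : List Formula) : Prop where
  correct : R.Correct
  hasConcls : R.ground.HasConcls
  conclTypes : R.conclTypes = Γ

theorem Correct.ground {R : PreStructure} (h : R.Correct) : R.ground.Correct :=
  ((correct_iff R).1 h).1

theorem Correct.content {R : PreStructure} (h : R.Correct) : R.ContentCorrect :=
  ((correct_iff R).1 h).2

theorem Sound.addNode {R : PreStructure} {Γ : List Formula} (h : R.Sound Γ) {l : NodeLabel}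
    {d : l = .box → PreStructure} {i k : ℕ} {outs : List Formula}
    (hc : (R.ground.addNode l i k outs).Correct) (hd : ∀ hl, (d hl).Correct) :
    (R.addNode l d i k outs).Sound (Γ.take i ++ outs ++ Γ.drop (i + k)) where
  correct := correct_addNode h.correct.content hc hd
  hasConcls := by rw [ground_addNode]; exact h.hasConcls.addNode _ _ _ _
  conclTypes := by rw [conclTypes_addNode, h.conclTypes]

theorem Sound.addNode_last {R : PreStructure} {Γ Θ outs : List Formula} (h : R.Sound (Γ ++ Θ))
    {l : NodeLabel} {d : l = .box → PreStructure} {k : ℕ} (hk : k = Θ.length)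
    (hc : (R.ground.addNode l Γ.length k outs).Correct) (hd : ∀ hl, (d hl).Correct) :
    (R.addNode l d Γ.length k outs).Sound (Γ ++ outs) := by
  simpa [hk] using h.addNode hc hd

theorem sound_empty_addNode {l : NodeLabel} {d : l = .box → PreStructure} {outs : List Formula}
    (hl : ¬ (l = .bot ∨ l = .weak)) (hd : ∀ hl, (d hl).Correct) :
    (empty.addNode l d 0 0 outs).Sound outs where
  correct := ⟨Ground.addNode_empty_correct hl, by
    rintro ⟨v | v, hv⟩
    exacts [v.elim, hd hv]⟩
  hasConcls := Ground.hasConcls_empty.addNode _ _ _ _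
  conclTypes := by rw [conclTypes_addNode]; simp [empty, PreStructure.conclTypes]

/-- A decomposition of the sequent lifts to the list of conclusion arcs; this is how the premises of
the node added by a rule are identified. -/
theorem Sound.exists_take_drop {R : PreStructure} {Γ Δ Θ : List Formula}
    (h : R.Sound (Γ ++ Δ ++ Θ)) : ∃ l₁ l₂ l₃, R.ground.concls = l₁ ++ l₂ ++ l₃ ∧
      l₁.length = Γ.length ∧ l₂.length = Δ.length ∧ l₃.length = Θ.length := by
  have := h.conclTypes
  rw [conclTypes_eq, List.map_eq_append_iff] at this
  obtain ⟨l, l₃, hl, h₁, rfl⟩ := this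
  obtain ⟨l₁, l₂, rfl, rfl, rfl⟩ := List.map_eq_append_iff.1 h₁
  exact ⟨l₁, l₂, l₃, hl, by simp, by simp, by simp⟩

theorem Sound.addNode_union {R S : PreStructure} {Γ Δ outs : List Formula} {A B : Formula}
    (hR : R.Sound (Γ ++ [A])) (hS : S.Sound ([B] ++ Δ)) {l : NodeLabel}
    {d : l = .box → PreStructure} (hl : ¬ (l = .bot ∨ l = .weak)) (hl' : ¬ (l = .par ∨ l = .con))
    (hd : ∀ hl, (d hl).Correct) :
    ((R.union S).addNode l d Γ.length 2 outs).Sound (Γ ++ outs ++ Δ) := by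
  have hU : (R.ground.union S.ground).HasConcls := hR.hasConcls.union hS.hasConcls
  obtain ⟨l₁, l₂, l₃, h, hl₁, hl₂, hl₃⟩ := Sound.exists_take_drop (Θ := []) (by simpa using hR)
  obtain ⟨m₁, m₂, m₃, h', hm₁, hm₂, hm₃⟩ := Sound.exists_take_drop (Γ := []) hS
  obtain ⟨a, rfl⟩ := List.length_eq_one_iff.1 hl₂
  obtain ⟨b, rfl⟩ := List.length_eq_one_iff.1 hm₂
  obtain rfl := List.length_eq_zero_iff.1 hl₃
  obtain rfl := List.length_eq_zero_iff.1 hm₁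
  have hc : ((R.ground.union S.ground).addNode l Γ.length 2 outs).Correct := by
    refine Ground.Correct.addNode_union hR.hasConcls hS.hasConcls hR.correct.ground
      hS.correct.ground hl hl' (a := a) (b := b) ?_
    simp [h, h', ← hl₁]
  constructor
  · refine correct_addNode (hR.correct.content.union hS.correct.content) ?_ hd
    rwa [ground_union]
  · rw [ground_addNode, ground_union]
    exact hU.addNode _ _ _ _
  · rw [conclTypes_addNode, conclTypes_union, hR.conclTypes, hS.conclTypes]
    simp

theorem Sound.exchange {R : PreStructure} {Γ Δ : List Formula} {A B : Formula}
    (h : R.Sound (Γ ++ [A, B] ++ Δ)) : (R.exchange Γ.length).Sound (Γ ++ [B, A] ++ Δ) := by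
  refine ⟨?_, ?_, conclTypes_exchange _ h.conclTypes⟩
  · obtain ⟨G, c⟩ := R
    exact ⟨h.correct.1.of_equiv (H := G.exchange Γ.length) (.refl G.Node) (.refl G.Arc) (fun _ => rfl) (fun _ => rfl) (by simp),
      h.correct.2⟩
  · have hc := h.hasConcls
    obtain ⟨G, c⟩ := R
    obtain ⟨l₁, l₂, l₃, hl, hl₁, hl₂, -⟩ : ∃ l₁ l₂ l₃ : List G.Arc, G.concls = l₁ ++ l₂ ++ l₃ ∧
      l₁.length = Γ.length ∧ l₂.length = 2 ∧ l₃.length = Δ.length := h.exists_take_drop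
    obtain ⟨a, b, rfl⟩ := List.length_eq_two.1 hl₂
    have hp : (G.exchange Γ.length).concls.Perm G.concls := by
      simp only [hl, ← hl₁]
      simpa [List.drop_append, List.drop_eq_nil_of_le] using (List.Perm.swap a b l₃).append_left l₁
    exact ⟨hc.finite_node, hc.finite_arc, hp.nodup_iff.2 hc.nodup_concls,
      fun a ha => hc.head_eq_none a (hp.mem_iff.1 ha)⟩

end PreStructure

open PreStructure in
-- Correctness alone would not be a sufficient invariant: the types and distinctness of the
-- conclusions guarantee that each rule finds the expected number of premises at the expected
-- positions.
theorem Proof.sound_deseq {Γ : List Formula} (π : Proof Γ) : π.deseq.Sound Γ := by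
  induction π with
  | ax A => exact sound_empty_addNode (by simp) nofun
  | one => exact sound_empty_addNode (by simp) nofun
  | promotion π ih => exact sound_empty_addNode (by simp) fun _ => ih.correct
  | cut π₁ π₂ ih₁ ih₂ =>
    simpa [deseq] using ih₁.addNode_union (l := .cut) (outs := []) ih₂ (by simp) (by simp) nofun
  | tensor π₁ π₂ ih₁ ih₂ => exact ih₁.addNode_union ih₂ (by simp) (by simp) nofun
  | ex π ih => exact ih.exchange
  | @par Γ A B π ih =>
    obtain ⟨l₁, l₂, l₃, hl, hl₁, hl₂, hl₃⟩ := Sound.exists_take_drop (Θ := []) (by simpa using ih)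
    obtain ⟨a, b, rfl⟩ := List.length_eq_two.1 hl₂
    exact ih.addNode_last rfl
      ((Ground.correct_addNode_par_con ih.hasConcls (.inl rfl) (a := a)
        (by simp [hl, ← hl₁])).2 ih.correct.ground) nofun
  | @contraction Γ A π ih =>
    obtain ⟨l₁, l₂, l₃, hl, hl₁, hl₂, hl₃⟩ := Sound.exists_take_drop (Θ := []) (by simpa using ih)
    obtain ⟨a, b, rfl⟩ := List.length_eq_two.1 hl₂
    exact ih.addNode_last rfl
      ((Ground.correct_addNode_par_con ih.hasConcls (.inr rfl) (a := a)
        (by simp [hl, ← hl₁])).2 ih.correct.ground) nofun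
  | @dereliction Γ A π ih =>
    obtain ⟨l₁, l₂, l₃, hl, hl₁, hl₂, hl₃⟩ := Sound.exists_take_drop (Θ := []) (by simpa using ih)
    obtain ⟨a, rfl⟩ := List.length_eq_one_iff.1 hl₂
    exact ih.addNode_last rfl
      ((Ground.correct_addNode_der ih.hasConcls (a := a)
        (by simp [hl, ← hl₁])).2 ih.correct.ground) nofun
  | @bot Γ π ih =>
    exact Sound.addNode_last (Θ := []) (by simpa using ih) rfl
      ((Ground.correct_addNode_bot_weak ih.hasConcls (.inl rfl)).2 ih.correct.ground) nofun
  | @weakening Γ A π ih =>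
    exact Sound.addNode_last (Θ := []) (by simpa using ih) rfl
      ((Ground.correct_addNode_bot_weak ih.hasConcls (.inr rfl)).2 ih.correct.ground) nofun

end MELL

-- Lists restricted to a subtype

section SubtypeList

variable {α : Type*} {q : α → Prop}

open Classical in
/-- The elements of `l` satisfying `q`, as elements of the subtype. -/
noncomputable def List.restrictTo (q : α → Prop) (l : List α) : List {a // q a} :=
  l.filterMap fun a => if h : q a then some ⟨a, h⟩ else none

theorem List.mem_restrictTo {l : List α} {x : {a // q a}} : x ∈ l.restrictTo q ↔ x.1 ∈ l := by
  rw [List.restrictTo, List.mem_filterMap]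
  constructor
  · rintro ⟨a, ha, h⟩
    by_cases hq : q a
    · rw [dif_pos hq, Option.some.injEq] at h
      subst h
      exact ha
    · simp [hq] at h
  · exact fun h => ⟨x.1, h, by rw [dif_pos x.2]⟩

theorem List.map_val_restrictTo {l : List α} (h : ∀ a ∈ l, q a) :
    (l.restrictTo q).map Subtype.val = l := by
  induction l with
  | nil => rfl
  | cons a l ih =>
    have ha := h a (by simp)
    have := ih fun b hb => h b (List.mem_cons_of_mem _ hb)
    rw [List.restrictTo] at this ⊢
    simp [ha, this]

theorem List.nodup_restrictTo {l : List α} (h : l.Nodup) : (l.restrictTo q).Nodup := by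
  refine h.filterMap fun a b x hx hy => ?_
  by_cases ha : q a <;> by_cases hb : q b <;> simp [ha, hb] at hx hy
  rw [← hy, Subtype.mk.injEq] at hx
  exact hx

end SubtypeList

-- Reordering the conclusions, and induced substructures

namespace MELL

/-- `G` with another list of conclusions. -/
abbrev Ground.withConcls (G : Ground) (l : List G.Arc) : Ground := { G with concls := l }

namespace PreStructure

/-- `R` is the desequentialization of a proof in `F` of the sequent `Γ`. -/
def SequentializableAs (F : Set Formula) (R : PreStructure) (Γ : List Formula) : Prop :=
  ∃ π : Proof Γ, π.InFragment F ∧ R.Iso π.deseq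

theorem Iso.exchange {R S : PreStructure} (h : R.Iso S) (i : ℕ) :
    (R.exchange i).Iso (S.exchange i) := by
  obtain ⟨G, c⟩ := R
  obtain ⟨H, d⟩ := S
  obtain ⟨e, f, hl, hy, ht, hh, hp, hb, hc, hi⟩ := h
  exact ⟨e, f, hl, hy, ht, hh, hp, hb, by simp [hc, List.map_drop, List.map_take], hi⟩

theorem SequentializableAs.of_iso {F : Set Formula} {R S : PreStructure} {Γ : List Formula}
    (h : S.SequentializableAs F Γ) (hRS : R.Iso S) : R.SequentializableAs F Γ := by
  obtain ⟨π, hπ, hS⟩ := h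
  exact ⟨π, hπ, hRS.trans hS⟩

/-- A permutation is a composite of adjacent swaps, each realized by an exchange rule. The prefix
`m` absorbs the common heads met by the induction on `List.Perm`. -/
theorem SequentializableAs.perm {F : Set Formula} {G : Ground}
    {c : {v : G.Node // G.label v = .box} → PreStructure} (hF : ∀ a, G.type a ∈ F)
    {l l' : List G.Arc} (h : l.Perm l') (m : List G.Arc)
    (hs : (mk (G.withConcls (m ++ l)) c).SequentializableAs F ((m ++ l).map G.type)) :
    (mk (G.withConcls (m ++ l')) c).SequentializableAs F ((m ++ l').map G.type) := by
  induction h generalizing m with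
  | nil => exact hs
  | cons a h ih =>
    rw [List.append_cons] at hs ⊢
    exact ih _ hs
  | trans _ _ ih₁ ih₂ => exact ih₂ m (ih₁ m hs)
  | swap a b l =>
    have e₁ : (m ++ b :: a :: l).map G.type =
      m.map G.type ++ [G.type b, G.type a] ++ l.map G.type := by simp
    have e₂ : (m ++ a :: b :: l).map G.type =
      m.map G.type ++ [G.type a, G.type b] ++ l.map G.type := by simp
    rw [e₁] at hs
    rw [e₂]
    obtain ⟨π, hπ, hi⟩ := hs
    refine ⟨.ex π, ⟨?_, hπ⟩, ?_⟩
    · intro C hC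
      rw [← e₂] at hC
      obtain ⟨x, -, rfl⟩ := List.mem_map.1 hC
      exact hF x
    · have := hi.exchange (m.map G.type).length
      have e : (mk (G.withConcls (m ++ b :: a :: l)) c).exchange (m.map G.type).length =
          mk (G.withConcls (m ++ a :: b :: l)) c := by
        simp [PreStructure.exchange, List.drop_append, List.drop_eq_nil_of_le]
      rwa [e] at this

end PreStructure

namespace Ground

/-- Some node satisfying `p` has no successor satisfying `p`. -/
theorem IsGraph.exists_maximal {G : Ground} (hG : G.IsGraph) (p : G.Node → Prop)
    (hp : ∃ v, p v) : ∃ v, p v ∧ ∀ a w, G.tail a = v → G.head a = some w → ¬ p w := by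
  have := hG.finite_node
  -- Reachability is reversed so that a minimal element is a node furthest along the arcs;
  -- acyclicity and finiteness make `r` well-founded.
  let r : G.Node → G.Node → Prop := fun u w =>
    Relation.TransGen (fun u w => ∃ a, G.tail a = u ∧ G.head a = some w) w u
  have : Std.Irrefl r := ⟨fun v => hG.dag v⟩
  have : IsTrans G.Node r := ⟨fun _ _ _ h h' => h'.trans h⟩
  have hwf : WellFounded r := Finite.wellFounded_of_trans_of_irrefl r
  obtain ⟨v, hv, hmin⟩ := hwf.has_min {v | p v} hp
  exact ⟨v, hv, fun a w ht hh hw => hmin w hw (.single ⟨a, ht, hh⟩)⟩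

open Classical in
/-- The structure induced on the nodes satisfying `p`, with conclusions `cs`. -/
noncomputable abbrev restrict (G : Ground) (p : G.Node → Prop)
    (cs : List {a : G.Arc // p (G.tail a)}) : Ground where
  Node := {v // p v}
  Arc := {a : G.Arc // p (G.tail a)}
  label v := G.label v.1
  type a := G.type a.1
  tail a := ⟨G.tail a.1, a.2⟩
  head a := (G.head a.1).bind fun v => if h : p v then some ⟨v, h⟩ else none
  prem v := (G.prem v.1).restrictTo _
  concl v := (G.concl v.1).restrictTo _
  concls := cs

variable {G : Ground} {p : G.Node → Prop} {cs : List {a : G.Arc // p (G.tail a)}}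

theorem restrict_head_eq_some {a : {a : G.Arc // p (G.tail a)}} {v : {v // p v}} :
    (G.restrict p cs).head a = some v ↔ G.head a.1 = some v.1 := by
  cases h : G.head a.1 with
  | none => simp [h]
  | some w =>
    by_cases hw : p w
    · simp [h, hw, Subtype.ext_iff]
    · simp only [h, Option.bind_some, hw, dite_false, reduceCtorEq, Option.some.injEq, false_iff]
      rintro rfl
      exact hw v.2

/-- Arcs leaving `p` become conclusions: this is how the premises of a removed node are released. -/
theorem restrict_head_eq_none {a : {a : G.Arc // p (G.tail a)}} :
    (G.restrict p cs).head a = none ↔ ∀ v, G.head a.1 = some v → ¬ p v := by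
  cases h : G.head a.1 with
  | none => simp [h]
  | some w => by_cases hw : p w <;> simp [h, hw]

theorem IsGraph.restrict (hG : G.IsGraph) (hn : cs.Nodup)
    (hcs : ∀ a, a ∈ cs ↔ (G.restrict p cs).head a = none) : (G.restrict p cs).IsGraph where
  finite_node := have := hG.finite_node; inferInstanceAs (Finite {v // p v})
  finite_arc := have := hG.finite_arc; inferInstanceAs (Finite {a : G.Arc // p (G.tail a)})
  dag v h := hG.dag v.1 <| Relation.TransGen.lift Subtype.val
    (fun _ _ ⟨a, ht, hh⟩ => ⟨a.1, congrArg Subtype.val ht, restrict_head_eq_some.1 hh⟩) _ _ h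
  nodup_prem v := List.nodup_restrictTo (hG.nodup_prem v.1)
  mem_prem v a := by
    rw [restrict_head_eq_some, ← hG.mem_prem]
    exact List.mem_restrictTo
  nodup_concl v := List.nodup_restrictTo (hG.nodup_concl v.1)
  mem_concl v a := by
    rw [Subtype.ext_iff, ← hG.mem_concl]
    exact List.mem_restrictTo
  nodup_concls := hn
  mem_concls := hcs

theorem map_val_concl_restrict (hG : G.IsGraph) (v : {v // p v}) :
    ((G.restrict p cs).concl v).map Subtype.val = G.concl v.1 :=
  List.map_val_restrictTo fun a ha => by rw [(hG.mem_concl _ _).1 ha]; exact v.2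

/-- Closure of `p` under predecessors is needed because an arc survives with its tail; otherwise a
surviving node could lose premises. -/
theorem map_val_prem_restrict (hG : G.IsGraph)
    (hp : ∀ a v, G.head a = some v → p v → p (G.tail a)) (v : {v // p v}) :
    ((G.restrict p cs).prem v).map Subtype.val = G.prem v.1 :=
  List.map_val_restrictTo fun a ha => hp a v.1 ((hG.mem_prem _ _).1 ha) v.2

end Ground

-- Decomposition of a structure up to isomorphism

namespace PreStructure

/-- The structure induced on the nodes satisfying `p`, with conclusions `cs`. -/
noncomputable def induce (G : Ground) (c : {v : G.Node // G.label v = .box} → PreStructure)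
    (p : G.Node → Prop) (cs : List {a : G.Arc // p (G.tail a)}) : PreStructure :=
  mk (G.restrict p cs) fun v => c ⟨v.1.1, v.2⟩

variable {G : Ground} {c : {v : G.Node // G.label v = .box} → PreStructure}

/-- Decomposition along a node whose conclusions are conclusions of the structure. -/
theorem iso_addNode_induce (hG : G.IsGraph) {v : G.Node} (hv : ∀ a ∈ G.concl v, G.head a = none)
    {l₁ l₂ : List G.Arc} {cs : List {a : G.Arc // G.tail a ≠ v}}
    (hcs : cs.map Subtype.val = l₁ ++ G.prem v ++ l₂) {l : NodeLabel} (hl : G.label v = l)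
    {d : l = .box → PreStructure} (hd : ∀ h, d h = c ⟨v, hl.trans h⟩) {i k : ℕ}
    (hi : l₁.length = i) (hk : (G.prem v).length = k)
    {outs : List Formula} (ho : (G.concl v).map G.type = outs) :
    (mk (G.withConcls (l₁ ++ G.concl v ++ l₂)) c).Iso
      ((induce G c (· ≠ v) cs).addNode l d i k outs) := by
  subst hl hi hk ho
  have ht : ((cs.drop l₁.length).take (G.prem v).length).map Subtype.val = G.prem v := by
    rw [List.map_take, List.map_drop, hcs]
    simp
  have hmem : ∀ a : {a : G.Arc // G.tail a ≠ v},
      a ∈ (cs.drop l₁.length).take (G.prem v).length ↔ G.head a.1 = some v := by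
    intro a
    rw [← hG.mem_prem]
    conv_rhs => rw [← ht]
    exact (List.mem_map_of_injective Subtype.val_injective).symm
  refine Iso.symm ?_
  -- The added node plays the role of `v`, and below its `i`-th output that of the `i`-th conclusion
  -- of `v`.
  let e : {u : G.Node // u ≠ v} ⊕ Unit → G.Node := Sum.elim Subtype.val fun _ => v
  have he : e.Bijective := by
    constructor
    · rintro (u | u) (w | w) h
      · exact congrArg _ (Subtype.ext h)
      · exact (u.2 h).elim
      · exact (w.2 h.symm).elim
      · rfl
    · intro u
      by_cases hu : u = v
      · exact ⟨.inr (), hu.symm⟩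
      · exact ⟨.inl ⟨u, hu⟩, rfl⟩
  let f : {a : G.Arc // G.tail a ≠ v} ⊕ Fin ((G.concl v).map G.type).length → G.Arc :=
    Sum.elim Subtype.val fun i => (G.concl v)[i.1]'(by simpa using i.2)
  have hft : ∀ i, G.tail (f (.inr i)) = v := fun i =>
    (hG.mem_concl v _).1 (List.getElem_mem _)
  have hf : f.Bijective := by
    constructor
    · rintro (a | a) (b | b) h
      · exact congrArg _ (Subtype.ext h)
      · exact (a.2 ((congrArg G.tail h).trans (hft b))).elim
      · exact (b.2 ((congrArg G.tail h).symm.trans (hft a))).elim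
      · exact congrArg _ (Fin.ext ((hG.nodup_concl v).getElem_inj_iff.1 h))
    · intro a
      by_cases ha : G.tail a = v
      · obtain ⟨i, hi, h⟩ := List.getElem_of_mem ((hG.mem_concl v a).2 ha)
        exact ⟨.inr ⟨i, by simpa using hi⟩, h⟩
      · exact ⟨.inl ⟨a, ha⟩, rfl⟩
  have hfin : (List.finRange _).map (fun i => f (.inr i)) = G.concl v := by
    refine List.ext_getElem (by simp) fun i h₁ h₂ => ?_
    simp [f]
  refine ⟨Equiv.ofBijective e he, Equiv.ofBijective f hf, ?_, ?_, ?_, ?_, ?_, ?_, ?_, ?_⟩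
  · rintro (u | u) <;> rfl
  · rintro (a | a)
    · rfl
    · simp [f]
  · rintro (a | a)
    · rfl
    · exact hft a
  · rintro (a | a)
    · change G.head a.1 = _
      by_cases ha : G.head a.1 = some v
      · simp [(hmem a).2 ha, ha, e]
      · simp only [Sum.elim_inl, mt (hmem a).1 ha, if_false]
        cases h : G.head a.1 with
        | none => simp
        | some w =>
          have hw : w ≠ v := by rintro rfl; exact ha h
          simp [hw, e]
    · exact hv _ (List.getElem_mem _)
  · rintro (u | u) -
    · have := Ground.map_val_prem_restrict (cs := cs) hG
        (fun a w ha _ hav => by simp [hv a ((hG.mem_concl v a).2 hav)] at ha) u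
      change G.prem u.1 = _
      simpa [f, Function.comp_def] using this.symm
    · simpa [f, Function.comp_def, e] using ht.symm
  · rintro (u | u) -
    · have := Ground.map_val_concl_restrict (cs := cs) hG u
      change G.concl u.1 = _
      simpa [f, Function.comp_def] using this.symm
    · simpa [Function.comp_def, e] using hfin.symm
  · have h₁ : (cs.take l₁.length).map Subtype.val = l₁ := by
      rw [List.map_take, hcs]; simp
    have h₂ : (cs.drop (l₁.length + (G.prem v).length)).map Subtype.val = l₂ := by
      rw [List.map_drop, hcs]; simp
    simp only [List.map_append, List.map_map]
    exact congrArg₂ _ (congrArg₂ _ h₁.symm hfin.symm) h₂.symm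
  · rintro ⟨u | u, hu⟩
    · exact Iso.refl _
    · have hu' : G.label v = .box := hu
      change (d hu').Iso (c ⟨v, hu'⟩)
      rw [hd]
      exact Iso.refl _

/-- Decomposition into two parts without arcs from one to the other. -/
theorem iso_union_induce (hG : G.IsGraph) {p : G.Node → Prop}
    (hp : ∀ a v, G.head a = some v → (p (G.tail a) ↔ p v)) {l₁ l₂ : List G.Arc}
    {cs₁ : List {a : G.Arc // p (G.tail a)}} {cs₂ : List {a : G.Arc // ¬ p (G.tail a)}}
    (h₁ : cs₁.map Subtype.val = l₁) (h₂ : cs₂.map Subtype.val = l₂) :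
    (mk (G.withConcls (l₁ ++ l₂)) c).Iso
      ((induce G c p cs₁).union (induce G c (¬ p ·) cs₂)) := by
  classical
  refine Iso.symm ⟨Equiv.sumCompl p, Equiv.sumCompl fun a => p (G.tail a), ?_, ?_, ?_, ?_, ?_, ?_,
    ?_, ?_⟩
  · rintro (u | u) <;> rfl
  · rintro (u | u) <;> rfl
  · rintro (u | u) <;> rfl
  · rintro (a | a)
    · change G.head a.1 = _
      cases h : G.head a.1 with
      | none => simp [h]
      | some w => simp [h, (hp _ _ h).1 a.2]
    · change G.head a.1 = _
      cases h : G.head a.1 with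
      | none => simp [h]
      | some w => simp [h, mt (hp _ _ h).2 a.2]
  · rintro (u | u) -
    · have := Ground.map_val_prem_restrict (cs := cs₁) hG (fun a w ha => (hp a w ha).2) u
      simpa [Function.comp_def] using this.symm
    · have := Ground.map_val_prem_restrict (cs := cs₂) hG
        (fun a w ha => mt (hp a w ha).1) u
      simpa [Function.comp_def] using this.symm
  · rintro (u | u) -
    · have := Ground.map_val_concl_restrict (cs := cs₁) hG u
      simpa [Function.comp_def] using this.symm
    · have := Ground.map_val_concl_restrict (cs := cs₂) hG u
      simpa [Function.comp_def] using this.symm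
  · simp [Function.comp_def, ← h₁, ← h₂]
  · rintro ⟨u | u, hu⟩ <;> exact Iso.refl _

end PreStructure

-- Splitting a tree at a terminal `⊗` node

namespace Ground

variable {G : Ground}

/-- Without `⅋` and `?c` nodes there is nothing to choose, hence a single switching graph. -/
theorem isLive_iff_of_forall_not (hno : ∀ u, ¬ (G.label u = .par ∨ G.label u = .con))
    (L : Set G.Arc) : G.IsLive L ↔ L = {a | G.head a ≠ none} := by
  constructor
  · intro h
    ext a
    refine ⟨h.head_ne a, fun ha => ?_⟩
    obtain ⟨v, hv⟩ := Option.ne_none_iff_exists'.1 ha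
    exact h.mem a v hv (hno v)
  · rintro rfl
    exact ⟨fun a ha => ha, fun a v hv _ => by simp [hv], fun v hv => (hno v hv).elim⟩

theorem numW_eq_zero (hw : ∀ u, ¬ (G.label u = .bot ∨ G.label u = .weak)) : G.numW = 0 := by
  simp [numW, hw]

/-- Removing a `⊗` node from a structure without `⅋` and `?c` nodes leaves two components. -/
theorem two_components_of_correct_addNode (hG : G.HasConcls)
    (hno : ∀ u, ¬ (G.label u = .par ∨ G.label u = .con))
    (hw : ∀ u, ¬ (G.label u = .bot ∨ G.label u = .weak)) {i : ℕ} {outs : List Formula}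
    {x y : G.Arc} (hxy : (G.concls.drop i).take 2 = [x, y]) (hne : x ≠ y)
    (hc : (G.addNode .tensor i 2 outs).Correct) :
    Nat.card G.Node = {a | G.head a ≠ none}.ncard + 2 ∧
      (∀ u, Relation.EqvGen (G.Link {a | G.head a ≠ none}) u (G.tail x) ∨
        Relation.EqvGen (G.Link {a | G.head a ≠ none}) u (G.tail y)) ∧
      ¬ Relation.EqvGen (G.Link {a | G.head a ≠ none}) (G.tail y) (G.tail x) := by
  have := hG.finite_node; have := hG.finite_arc
  set L : Set G.Arc := {a | G.head a ≠ none}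
  have hL : G.IsLive L := (isLive_iff_of_forall_not hno L).2 rfl
  have hS : Selects .tensor ((G.concls.drop i).take 2) ({x, y} : Set G.Arc) := by
    rw [hxy]
    exact ⟨by simp, by simp, by simp⟩
  obtain ⟨h₁, h₂⟩ := hc _ (isLive_addNode (outs := outs) hG hL hS)
  rw [ncard_addNode hL hG hS, Set.ncard_pair hne, card_node_addNode] at h₂
  have hn := G.numW_addNode_of_not (l := .tensor) i 2 outs (by simp)
  rw [numW_eq_zero hw] at hn
  rw [hn] at h₁ h₂
  obtain ⟨q, hq⟩ := Nat.card_eq_one_iff_exists.1 h₁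
  -- `W` is invariant under links and true at the new node. As the switching graph has only one
  -- class, it is true everywhere: each node of `G` is connected to one of the two premises.
  let W : G.Node ⊕ Unit → Prop := Sum.elim
    (fun u => Relation.EqvGen (G.Link L) u (G.tail x) ∨ Relation.EqvGen (G.Link L) u (G.tail y))
    fun _ => True
  have hW : ∀ a b, (G.addNode .tensor i 2 outs).Link (Sum.inl '' (L ∪ {x, y})) a b →
      W a = W b := by
    rintro (u | u) (w | w) h
    · have hl := Relation.EqvGen.rel _ _ ((link_addNode_inl_inl hL hG hS u w).1 h)
      exact propext ⟨Or.imp (hl.symm.trans _ _ _) (hl.symm.trans _ _ _),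
        Or.imp (hl.trans _ _ _) (hl.trans _ _ _)⟩
    · obtain ⟨a, rfl | rfl, rfl⟩ := (link_addNode_inl_inr hL hG hS u w).1 h
      · exact propext ⟨fun _ => trivial, fun _ => .inl (.refl _)⟩
      · exact propext ⟨fun _ => trivial, fun _ => .inr (.refl _)⟩
    · exact (not_link_addNode_inr _ _ h).elim
    · exact (not_link_addNode_inr _ _ h).elim
  have hcover : ∀ u, W (.inl u) := fun u => by
    have := congrArg (Quot.lift W hW) ((hq (Quot.mk _ (.inl u))).trans
      (hq (Quot.mk _ (.inr ()))).symm)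
    exact (show W (.inl u) = W (.inr ()) from this) ▸ trivial
  refine ⟨by omega, hcover, fun hyx => ?_⟩
  -- If the two premises were connected, `G` would be connected with `|L| + 2` nodes, one more than
  -- `|L|` arcs can connect.
  have hone : numClasses (G.Link L) = 1 := by
    refine Nat.card_eq_one_iff_exists.2 ⟨Quot.mk _ (G.tail x), fun q => ?_⟩
    induction q using Quot.ind with
    | _ u =>
    exact Quot.eqvGen_sound ((hcover u).elim id fun h => h.trans _ _ _ hyx)
  have := card_node_le G L hL.head_ne
  omega

section Split

variable {p : G.Node → Prop} {cs : List {a : G.Arc // p (G.tail a)}}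

theorem restrict_head_ne_none (hp : ∀ a v, G.head a = some v → (p (G.tail a) ↔ p v))
    (a : {a : G.Arc // p (G.tail a)}) :
    (G.restrict p cs).head a ≠ none ↔ G.head a.1 ≠ none := by
  rw [Ne, restrict_head_eq_none, not_iff_not]
  refine ⟨fun h => ?_, fun h v hv => by simp [h] at hv⟩
  by_contra hne
  obtain ⟨v, hv⟩ := Option.ne_none_iff_exists'.1 hne
  exact h v hv ((hp _ v hv).1 a.2)

/-- No arc crosses the boundary of `p`, so a chain of links starting in `p` stays in `p` and
survives in the restriction. -/
theorem numClasses_restrict_eq_one (hp : ∀ a v, G.head a = some v → (p (G.tail a) ↔ p v))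
    {x : G.Node} (hx : p x)
    (hconn : ∀ u, p u → Relation.EqvGen (G.Link {a | G.head a ≠ none}) u x) :
    numClasses ((G.restrict p cs).Link {a | (G.restrict p cs).head a ≠ none}) = 1 := by
  have key : ∀ u w, Relation.EqvGen (G.Link {a | G.head a ≠ none}) u w → (p u ↔ p w) ∧
      ∀ (hu : p u) (hw : p w), Relation.EqvGen
        ((G.restrict p cs).Link {a | (G.restrict p cs).head a ≠ none}) ⟨u, hu⟩ ⟨w, hw⟩ := by
    intro u w h
    induction h with
    | rel u w h =>
      obtain ⟨a, ha, rfl, hh⟩ := h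
      exact ⟨hp a w hh, fun hu hw => .rel _ _
        ⟨⟨a, hu⟩, (restrict_head_ne_none hp _).2 ha, rfl, restrict_head_eq_some.2 hh⟩⟩
    | refl u => exact ⟨.rfl, fun _ _ => .refl _⟩
    | symm u w _ ih => exact ⟨ih.1.symm, fun hu hw => (ih.2 hw hu).symm⟩
    | trans u v w _ _ ih₁ ih₂ =>
      exact ⟨ih₁.1.trans ih₂.1, fun hu hw =>
        (ih₁.2 hu (ih₁.1.1 hu)).trans _ _ _ (ih₂.2 (ih₁.1.1 hu) hw)⟩
  refine Nat.card_eq_one_iff_exists.2 ⟨Quot.mk _ ⟨x, hx⟩, fun q => ?_⟩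
  induction q using Quot.ind with
  | _ u => exact Quot.eqvGen_sound ((key _ _ (hconn u.1 u.2)).2 u.2 hx)

/-- The two components of a structure without `⅋`, `?c`, `⊥` and `?w` nodes are correct. -/
theorem correct_restrict_of_two_components [Finite G.Node] [Finite G.Arc]
    (hno : ∀ u, ¬ (G.label u = .par ∨ G.label u = .con))
    (hw : ∀ u, ¬ (G.label u = .bot ∨ G.label u = .weak))
    (hp : ∀ a v, G.head a = some v → (p (G.tail a) ↔ p v))
    (hcard : Nat.card G.Node = {a | G.head a ≠ none}.ncard + 2) {x y : G.Node} (hx : p x)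
    (hconn : ∀ u, p u → Relation.EqvGen (G.Link {a | G.head a ≠ none}) u x) (hy : ¬ p y)
    (hconn' : ∀ u, ¬ p u → Relation.EqvGen (G.Link {a | G.head a ≠ none}) u y)
    {cs' : List {a : G.Arc // ¬ p (G.tail a)}} :
    (G.restrict p cs).Correct ∧ (G.restrict (¬ p ·) cs').Correct := by
  classical
  have hp' : ∀ a v, G.head a = some v → (¬ p (G.tail a) ↔ ¬ p v) := fun a v h =>
    not_iff_not.2 (hp a v h)
  have c₁ := numClasses_restrict_eq_one (cs := cs) hp hx hconn
  have c₂ := numClasses_restrict_eq_one (cs := cs') hp' hy hconn'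
  have : Finite (G.restrict p cs).Node := inferInstanceAs (Finite {v // p v})
  have : Finite (G.restrict (¬ p ·) cs').Node := inferInstanceAs (Finite {v // ¬ p v})
  have : Finite (G.restrict p cs).Arc := inferInstanceAs (Finite {a : G.Arc // p (G.tail a)})
  have : Finite (G.restrict (¬ p ·) cs').Arc :=
    inferInstanceAs (Finite {a : G.Arc // ¬ p (G.tail a)})
  have n₁ := card_node_le (G.restrict p cs) {a | (G.restrict p cs).head a ≠ none} fun a ha => ha
  have n₂ := card_node_le (G.restrict (¬ p ·) cs') {a | (G.restrict (¬ p ·) cs').head a ≠ none} fun a ha => ha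
  rw [c₁] at n₁
  rw [c₂] at n₂
  have hN : Nat.card (G.restrict p cs).Node + Nat.card (G.restrict (¬ p ·) cs').Node =
      Nat.card G.Node := by
    rw [← Nat.card_sum]
    exact Nat.card_congr (Equiv.sumCompl p)
  -- Each connected part has at most one node more than arcs, and the two parts together have two
  -- nodes more than `G` has arcs with a head. Once the arcs of the parts do not exceed those of
  -- `G`, both bounds must be equalities.
  have hL : {a | (G.restrict p cs).head a ≠ none}.ncard +
      {a | (G.restrict (¬ p ·) cs').head a ≠ none}.ncard ≤ {a | G.head a ≠ none}.ncard := by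
    rw [← Set.ncard_image_of_injective _ (Subtype.val_injective (p := fun a => p (G.tail a))),
      ← Set.ncard_image_of_injective _ (Subtype.val_injective (p := fun a => ¬ p (G.tail a))),
      ← Set.ncard_union_eq ?_ (Set.toFinite _) (Set.toFinite _)]
    · refine Set.ncard_le_ncard ?_ (Set.toFinite _)
      rintro _ (⟨a, ha, rfl⟩ | ⟨a, ha, rfl⟩)
      exacts [(restrict_head_ne_none hp a).1 ha, (restrict_head_ne_none (p := (¬ p ·)) hp' a).1 ha]
    · rw [Set.disjoint_left]
      rintro _ ⟨a, -, rfl⟩ ⟨b, -, h⟩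
      exact b.2 (h ▸ a.2)
  constructor
  · intro L hlive
    rw [isLive_iff_of_forall_not fun u : {u // p u} => hno u.1] at hlive
    rw [hlive, c₁, numW_eq_zero fun u : {u // p u} => hw u.1]
    omega
  · intro L hlive
    rw [isLive_iff_of_forall_not fun u : {u // ¬ p u} => hno u.1] at hlive
    rw [hlive, c₂, numW_eq_zero fun u : {u // ¬ p u} => hw u.1]
    omega

end Split

end Ground

-- The invariant of the sequentialization, and removal of a terminal node

namespace PreStructure

theorem Iso.ground_correct {R S : PreStructure} (h : R.Iso S) (hR : R.ground.Correct) :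
    S.ground.Correct := by
  obtain ⟨G, c⟩ := R
  obtain ⟨H, d⟩ := S
  obtain ⟨e, f, hl, -, ht, hh, -⟩ := h
  exact Ground.Correct.of_equiv e f hl ht hh hR

theorem iso_empty {G : Ground} {c : {v : G.Node // G.label v = .box} → PreStructure}
    [IsEmpty G.Node] : (mk G c).Iso empty := by
  have : IsEmpty G.Arc := ⟨fun a => IsEmpty.false (G.tail a)⟩
  refine ⟨.equivOfIsEmpty _ Empty, .equivOfIsEmpty _ Empty, isEmptyElim, isEmptyElim, isEmptyElim,
    isEmptyElim, isEmptyElim, isEmptyElim, ?_, fun v => isEmptyElim v.1⟩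
  have hnil : G.concls = [] := List.eq_nil_iff_forall_not_mem.2 fun a => isEmptyElim a
  rw [hnil]
  rfl

variable {G : Ground} {c : {v : G.Node // G.label v = .box} → PreStructure}

/-- A cut-free proof-structure in the polarized fragment, the contents of whose boxes are
sequentializable. -/
structure Ready (G : Ground) (c : {v : G.Node // G.label v = .box} → PreStructure) : Prop where
  graph : G.IsGraph
  typed : ∀ v, G.label v ≠ .box →
    (G.label v).Typed ((G.prem v).map G.type) ((G.concl v).map G.type)
  mem : ∀ a, G.type a ∈ LLpol
  label_ne_cut : ∀ v, G.label v ≠ .cut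
  box : ∀ v, G.prem v.1 = [] ∧ ∃ (Γ : List Formula) (A : Formula),
    (c v).SequentializableAs LLpol (Γ.map .whynot ++ [A]) ∧
    (G.concl v.1).map G.type = Γ.map .whynot ++ [.bang A]

theorem Ready.hasConcls (h : Ready G c) : G.HasConcls :=
  ⟨h.graph.finite_node, h.graph.finite_arc, h.graph.nodup_concls,
    fun a ha => (h.graph.mem_concls a).1 ha⟩

theorem Ready.restrict (h : Ready G c) {p : G.Node → Prop}
    (hp : ∀ a v, G.head a = some v → p v → p (G.tail a))
    {cs : List {a : G.Arc // p (G.tail a)}} (hn : cs.Nodup)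
    (hcs : ∀ a, a ∈ cs ↔ (G.restrict p cs).head a = none) :
    Ready (G.restrict p cs) fun v => c ⟨v.1.1, v.2⟩ where
  graph := h.graph.restrict hn hcs
  typed v hv := by
    have := h.typed v.1 hv
    rw [← Ground.map_val_prem_restrict (cs := cs) h.graph hp v,
      ← Ground.map_val_concl_restrict (cs := cs) h.graph v, List.map_map, List.map_map] at this
    exact this
  mem a := h.mem a.1
  label_ne_cut v := h.label_ne_cut v.1
  box v := by
    obtain ⟨h₁, Γ, A, h₂, h₃⟩ := h.box ⟨v.1.1, v.2⟩
    refine ⟨?_, Γ, A, h₂, ?_⟩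
    · have := Ground.map_val_prem_restrict (cs := cs) h.graph hp v.1
      rw [h₁] at this
      exact List.map_eq_nil_iff.1 this
    · rw [← Ground.map_val_concl_restrict (cs := cs) h.graph v.1, List.map_map] at h₃
      exact h₃

/-- Removing a node whose conclusions are conclusions of the structure. -/
theorem Ready.exists_remove (h : Ready G c) {v : G.Node}
    (hv : ∀ a ∈ G.concl v, G.head a = none) {l₁ l₂ : List G.Arc}
    (hn : (l₁ ++ l₂).Nodup) (hl : ∀ a, a ∈ l₁ ++ l₂ ↔ G.head a = none ∧ G.tail a ≠ v) :
    ∃ cs : List {a : G.Arc // G.tail a ≠ v}, cs.map Subtype.val = l₁ ++ G.prem v ++ l₂ ∧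
      Ready (G.restrict (· ≠ v) cs) fun v => c ⟨v.1.1, v.2⟩ := by
  have htail : ∀ a w, G.head a = some w → G.tail a ≠ v := fun a w ha hav => by
    simp [hv a ((h.graph.mem_concl v a).2 hav)] at ha
  have hmem : ∀ a, a ∈ l₁ ++ G.prem v ++ l₂ ↔
      (G.head a = none ∧ G.tail a ≠ v) ∨ G.head a = some v := fun a => by
    rw [← hl, ← h.graph.mem_prem]
    simp only [List.mem_append]
    tauto
  have hnd : (l₁ ++ G.prem v ++ l₂).Nodup := by
    have hp : (l₁ ++ G.prem v ++ l₂).Perm (G.prem v ++ (l₁ ++ l₂)) := by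
      rw [← List.append_assoc]
      exact List.perm_append_comm.append_right _
    rw [hp.nodup_iff]
    refine (h.graph.nodup_prem v).append hn fun a ha ha' => ?_
    rw [h.graph.mem_prem] at ha
    simp [((hl a).1 ha').1] at ha
  refine ⟨(l₁ ++ G.prem v ++ l₂).restrictTo _, List.map_val_restrictTo fun a ha => ?_,
    h.restrict (fun a w ha _ => htail a w ha) (List.nodup_restrictTo hnd) fun a => ?_⟩
  · rcases (hmem a).1 ha with ha | ha
    exacts [ha.2, htail a v ha]
  · rw [List.mem_restrictTo, hmem, Ground.restrict_head_eq_none]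
    constructor
    · rintro (⟨ha, -⟩ | ha) w hw
      · simp [ha] at hw
      · simp [Option.some.inj (ha.symm.trans hw)]
    · intro ha
      cases hh : G.head a.1 with
      | none => exact .inl ⟨rfl, a.2⟩
      | some w => exact .inr (congrArg some (not_not.1 (ha w hh)))

/-- It suffices to sequentialize with the conclusions listed in the order that suits the last rule,
here around those of `v`; exchanges restore the original order. -/
theorem Ready.of_addNode (h : Ready G c) {v : G.Node}
    (hv : ∀ a ∈ G.concl v, G.head a = none) {l₁ l₂ : List G.Arc}
    (hn : (l₁ ++ l₂).Nodup) (hl : ∀ a, a ∈ l₁ ++ l₂ ↔ G.head a = none ∧ G.tail a ≠ v)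
    {S : PreStructure} (hS : (PreStructure.mk (G.withConcls (l₁ ++ G.concl v ++ l₂)) c).Iso S)
    (hs : S.SequentializableAs LLpol ((l₁ ++ G.concl v ++ l₂).map G.type)) :
    (PreStructure.mk G c).SequentializableAs LLpol (G.concls.map G.type) := by
  refine SequentializableAs.perm h.mem (l' := G.concls) ?_ [] (hs.of_iso hS)
  have hp : (l₁ ++ G.concl v ++ l₂).Perm (G.concl v ++ (l₁ ++ l₂)) := by
    rw [← List.append_assoc]
    exact List.perm_append_comm.append_right _
  refine hp.trans ((List.perm_ext_iff_of_nodup ?_ h.graph.nodup_concls).2 fun a => ?_)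
  · refine (h.graph.nodup_concl v).append hn fun a ha ha' => ?_
    exact ((hl a).1 ha').2 ((h.graph.mem_concl v a).1 ha)
  · rw [List.mem_append, hl, h.graph.mem_concl, h.graph.mem_concls]
    constructor
    · rintro (ha | ha)
      exacts [hv a ((h.graph.mem_concl v a).2 ha), ha.1]
    · exact fun ha => (em _).imp_right fun h => ⟨ha, h⟩

end PreStructure

-- Last rules and induction steps

namespace PreStructure

section Rules

variable {F : Set Formula} {R S : PreStructure} {Γ Δ : List Formula} {A B : Formula}

theorem SequentializableAs.par (h : R.SequentializableAs F (Γ ++ [A, B]))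
    (hF : ∀ C ∈ Γ ++ [.par A B], C ∈ F) (d : NodeLabel.par = .box → PreStructure) :
    (R.addNode .par d Γ.length 2 [.par A B]).SequentializableAs F (Γ ++ [.par A B]) := by
  obtain ⟨π, hπ, hi⟩ := h
  exact ⟨.par π, ⟨hF, hπ⟩, hi.addNode (l := .par) (fun h => by cases h) _ _ _⟩

theorem SequentializableAs.contraction (h : R.SequentializableAs F (Γ ++ [.whynot A, .whynot A]))
    (hF : ∀ C ∈ Γ ++ [.whynot A], C ∈ F) (d : NodeLabel.con = .box → PreStructure) :
    (R.addNode .con d Γ.length 2 [.whynot A]).SequentializableAs F (Γ ++ [.whynot A]) := by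
  obtain ⟨π, hπ, hi⟩ := h
  exact ⟨.contraction π, ⟨hF, hπ⟩, hi.addNode (l := .con) (fun h => by cases h) _ _ _⟩

theorem SequentializableAs.dereliction (h : R.SequentializableAs F (Γ ++ [A]))
    (hF : ∀ C ∈ Γ ++ [.whynot A], C ∈ F) (d : NodeLabel.der = .box → PreStructure) :
    (R.addNode .der d Γ.length 1 [.whynot A]).SequentializableAs F (Γ ++ [.whynot A]) := by
  obtain ⟨π, hπ, hi⟩ := h
  exact ⟨.dereliction π, ⟨hF, hπ⟩, hi.addNode (l := .der) (fun h => by cases h) _ _ _⟩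

theorem SequentializableAs.bot (h : R.SequentializableAs F Γ)
    (hF : ∀ C ∈ Γ ++ [.bot], C ∈ F) (d : NodeLabel.bot = .box → PreStructure) :
    (R.addNode .bot d Γ.length 0 [.bot]).SequentializableAs F (Γ ++ [.bot]) := by
  obtain ⟨π, hπ, hi⟩ := h
  exact ⟨.bot π, ⟨hF, hπ⟩, hi.addNode (l := .bot) (fun h => by cases h) _ _ _⟩

theorem SequentializableAs.weakening (h : R.SequentializableAs F Γ)
    (hF : ∀ C ∈ Γ ++ [.whynot A], C ∈ F) (d : NodeLabel.weak = .box → PreStructure) :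
    (R.addNode .weak d Γ.length 0 [.whynot A]).SequentializableAs F (Γ ++ [.whynot A]) := by
  obtain ⟨π, hπ, hi⟩ := h
  exact ⟨.weakening π, ⟨hF, hπ⟩, hi.addNode (l := .weak) (fun h => by cases h) _ _ _⟩

theorem SequentializableAs.tensor (h : R.SequentializableAs F (Γ ++ [A]))
    (h' : S.SequentializableAs F ([B] ++ Δ)) (hF : ∀ C ∈ Γ ++ [.tensor A B] ++ Δ, C ∈ F)
    (d : NodeLabel.tensor = .box → PreStructure) :
    ((R.union S).addNode .tensor d Γ.length 2 [.tensor A B]).SequentializableAs F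
      (Γ ++ [.tensor A B] ++ Δ) := by
  obtain ⟨π, hπ, hi⟩ := h
  obtain ⟨π', hπ', hi'⟩ := h'
  exact ⟨.tensor π π', ⟨hF, hπ, hπ'⟩, 
    (hi.union hi').addNode (l := .tensor) (fun h => by cases h) _ _ _⟩

end Rules

variable {G : Ground} {c : {v : G.Node // G.label v = .box} → PreStructure}

/-- Since `p` is a union of components, no arc is cut, and the conclusions of the part are just
those of `G` whose tail lies in `p`. -/
theorem Ready.restrict_part (h : Ready G c) {p : G.Node → Prop}
    (hp : ∀ a v, G.head a = some v → (p (G.tail a) ↔ p v)) {m m' : List G.Arc}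
    (hm : ∀ a, a ∈ G.concls ↔ a ∈ m ∨ a ∈ m') (hn : m.Nodup) (hm' : ∀ a ∈ m', ¬ p (G.tail a)) :
    Ready (G.restrict p (m.restrictTo _)) fun v => c ⟨v.1.1, v.2⟩ := by
  refine h.restrict (fun a v ha => (hp a v ha).2) (List.nodup_restrictTo hn) fun a => ?_
  rw [List.mem_restrictTo, not_iff_not.1 (Ground.restrict_head_ne_none hp a),
    ← h.graph.mem_concls, hm]
  exact ⟨.inl, fun ha => ha.resolve_right fun h' => hm' _ h' a.2⟩

/-- The correct structures with fewer nodes than `G` are sequentializable. -/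
def SmallerSequentializable (G : Ground) : Prop :=
  ∀ (H : Ground) (d : {v : H.Node // H.label v = .box} → PreStructure),
    Nat.card H.Node < Nat.card G.Node → Ready H d → H.Correct →
      (mk H d).SequentializableAs LLpol (H.concls.map H.type)

theorem card_ne_lt [Finite G.Node] (v : G.Node) :
    Nat.card {u : G.Node // u ≠ v} < Nat.card G.Node :=
  Finite.card_subtype_lt (x := v) (by simp)

open Classical in
/-- Sequentialization when some conclusion is that of a node of one of the kinds
`⅋`, `?c`, `?d`, `⊥`, `?w`. -/
theorem Ready.sequentializableAs_unary (h : Ready G c) (hG : G.Correct)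
    (ih : SmallerSequentializable G) {v : G.Node} (hv : ∀ a ∈ G.concl v, G.head a = none)
    {l : NodeLabel} (hl : G.label v = l) {Θ : List Formula} {C : Formula}
    (hprem : (G.prem v).map G.type = Θ) (hconcl : (G.concl v).map G.type = [C])
    (hcor : ∀ (H : Ground) (i : ℕ) (outs : List Formula), H.HasConcls →
      ((H.concls.drop i).take Θ.length).length = Θ.length →
      (H.addNode l i Θ.length outs).Correct → H.Correct)
    (hrule : ∀ (Γ : List Formula) (R : PreStructure) (d : l = .box → PreStructure),
      (∀ C' ∈ Γ ++ [C], C' ∈ LLpol) → R.SequentializableAs LLpol (Γ ++ Θ) →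
      (R.addNode l d Γ.length Θ.length [C]).SequentializableAs LLpol (Γ ++ [C])) :
    (PreStructure.mk G c).SequentializableAs LLpol (G.concls.map G.type) := by
  have := h.graph.finite_node
  -- The conclusion of `v` is moved to the last position, where the unary rules act; the list after
  -- it is empty.
  set l₁ := G.concls.filter (G.tail · ≠ v) with hl₁
  have hn : (l₁ ++ []).Nodup := by simpa [hl₁] using h.graph.nodup_concls.filter _
  have hmem : ∀ a, a ∈ l₁ ++ [] ↔ G.head a = none ∧ G.tail a ≠ v := fun a => by
    simp [hl₁, h.graph.mem_concls]
  obtain ⟨cs, hcs, hr⟩ := h.exists_remove hv hn hmem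
  have hk : (G.prem v).length = Θ.length := by rw [← hprem, List.length_map]
  have hi := iso_addNode_induce (c := c) h.graph hv hcs hl
    (d := fun h => c ⟨v, hl.trans h⟩) (fun _ => rfl) rfl hk hconcl
  refine h.of_addNode hv hn hmem hi ?_
  -- Correctness passes to the structure rebuilt by adding `v` again, from which `hcor` strips the
  -- node.
  have hc : (G.restrict (· ≠ v) cs).Correct := by
    refine hcor _ l₁.length [C] hr.hasConcls ?_ (hi.ground_correct ?_)
    · have : cs.length = l₁.length + Θ.length := by
        rw [← List.length_map (f := Subtype.val), hcs]
        simp [hk]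
      simp [this]
    · exact hG.of_equiv (H := G.withConcls (l₁ ++ G.concl v ++ [])) (.refl G.Node) (.refl G.Arc)
        (fun _ => rfl) (fun _ => rfl) (by simp)
  have hs := ih _ _ (card_ne_lt v) hr hc
  have ht : (G.restrict (· ≠ v) cs).concls.map (G.restrict (· ≠ v) cs).type =
      l₁.map G.type ++ Θ := by
    have := congrArg (List.map G.type) hcs
    rw [List.map_map, List.append_nil, List.map_append, hprem] at this
    exact this
  rw [ht] at hs
  have ht' : (l₁ ++ G.concl v ++ []).map G.type = l₁.map G.type ++ [C] := by simp [hconcl]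
  have hF : ∀ C' ∈ l₁.map G.type ++ [C], C' ∈ LLpol := fun C' hC' => by
    rw [← ht'] at hC'
    obtain ⟨a, -, rfl⟩ := List.mem_map.1 hC'
    exact h.mem a
  have := hrule _ _ (fun h => c ⟨v, hl.trans h⟩) hF hs
  rw [List.length_map] at this
  rw [ht']
  exact this

/-- Sequentialization of a structure with a single node, without premises. -/
theorem Ready.sequentializableAs_of_unique (h : Ready G c) {v : G.Node} (hv : ∀ u, u = v)
    (hprem : G.prem v = []) {l : NodeLabel} (hl : G.label v = l) {outs : List Formula}
    (ho : (G.concl v).map G.type = outs)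
    (hs : (empty.addNode l (fun h => c ⟨v, hl.trans h⟩) 0 0 outs).SequentializableAs LLpol outs) :
    (PreStructure.mk G c).SequentializableAs LLpol (G.concls.map G.type) := by
  have hc : ∀ a ∈ G.concl v, G.head a = none := fun a _ => by
    by_contra hne
    obtain ⟨w, hw⟩ := Option.ne_none_iff_exists'.1 hne
    obtain rfl := hv w
    rw [← h.graph.mem_prem, hprem] at hw
    simp at hw
  have hn : ([] ++ [] : List G.Arc).Nodup := by simp
  have hmem : ∀ a, a ∈ ([] ++ [] : List G.Arc) ↔ G.head a = none ∧ G.tail a ≠ v := fun a => by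
    simp [hv (G.tail a)]
  obtain ⟨cs, hcs, -⟩ := h.exists_remove hc hn hmem
  have hi := iso_addNode_induce (c := c) h.graph hc hcs hl
    (d := fun h => c ⟨v, hl.trans h⟩) (fun _ => rfl) rfl (congrArg List.length hprem) ho
  refine h.of_addNode hc hn hmem (S := empty.addNode l (fun h => c ⟨v, hl.trans h⟩) 0 0 outs)
    (hi.trans (Iso.addNode ?_ (fun _ => .refl _) _ _ _)) (by simpa [ho] using hs)
  have : IsEmpty (G.restrict (· ≠ v) cs).Node := ⟨fun u => u.2 (hv u.1)⟩
  exact iso_empty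

open Classical in
/-- Sequentialization when some conclusion is that of a `⊗` node and there are only nodes of the
kinds `ax`, `1`, `⊗` and boxes. -/
theorem Ready.sequentializableAs_tensor (h : Ready G c) (hG : G.Correct)
    (ih : SmallerSequentializable G) {v : G.Node} (hv : ∀ a ∈ G.concl v, G.head a = none)
    (hno : ∀ u, ¬ (G.label u = .par ∨ G.label u = .con))
    (hw : ∀ u, ¬ (G.label u = .bot ∨ G.label u = .weak))
    (hl : G.label v = .tensor) {A B : Formula} {a b : G.Arc} (hprem : G.prem v = [a, b])
    (ha : G.type a = A) (hb : G.type b = B) (hconcl : (G.concl v).map G.type = [.tensor A B]) :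
    (PreStructure.mk G c).SequentializableAs LLpol (G.concls.map G.type) := by
  have := h.graph.finite_node
  have := h.graph.finite_arc
  have htail : ∀ x w, G.head x = some w → G.tail x ≠ v := fun x w hx hxv => by
    simp [hv x ((h.graph.mem_concl v x).2 hxv)] at hx
  have hav : G.tail a ≠ v := htail a v ((h.graph.mem_prem v a).1 (by simp [hprem]))
  have hbv : G.tail b ≠ v := htail b v ((h.graph.mem_prem v b).1 (by simp [hprem]))
  have hab : a ≠ b := by
    have := h.graph.nodup_prem v
    rw [hprem] at this
    simpa using this
  -- This first removal of `v`, with the other conclusions in arbitrary grouping, only serves to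
  -- find the two components. The conclusions can be sorted by component, as the `⊗` rule requires,
  -- only afterwards.
  set l₀ := G.concls.filter (G.tail · ≠ v) with hl₀
  have hmem₀ : ∀ e, e ∈ l₀ ++ [] ↔ G.head e = none ∧ G.tail e ≠ v := fun e => by
    simp [hl₀, h.graph.mem_concls]
  obtain ⟨cs₀, hcs₀, hr₀⟩ := h.exists_remove hv
    (by simpa [hl₀] using h.graph.nodup_concls.filter _) hmem₀
  have hi₀ := iso_addNode_induce (c := c) h.graph hv hcs₀ hl
    (d := fun h => c ⟨v, hl.trans h⟩) (fun _ => rfl) rfl (congrArg List.length hprem) hconcl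
  have hc₀ := hi₀.ground_correct (hG.of_equiv (H := G.withConcls (l₀ ++ G.concl v ++ []))
    (.refl G.Node) (.refl G.Arc) (fun _ => rfl) (fun _ => rfl) (by simp))
  obtain ⟨hcard, hcover, hnot⟩ := Ground.two_components_of_correct_addNode hr₀.hasConcls
    (fun u => hno u.1) (fun u => hw u.1) (x := ⟨a, hav⟩) (y := ⟨b, hbv⟩)
    (List.map_injective_iff.2 Subtype.val_injective (by
      rw [List.map_take, List.map_drop, hcs₀, hprem]; simp))
    (fun h => hab (congrArg Subtype.val h)) hc₀
  -- `q` is the component of the left premise. Links do not depend on the list of conclusions, so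
  -- `q` and its properties remain valid when `cs₀` is replaced by the sorted list.
  set q : {u : G.Node // u ≠ v} → Prop := fun u => Relation.EqvGen
    ((G.restrict (· ≠ v) cs₀).Link {e | (G.restrict (· ≠ v) cs₀).head e ≠ none}) u
    ⟨G.tail a, hav⟩
  have hqclosed : ∀ e w, (G.restrict (· ≠ v) cs₀).head e = some w →
      (q ((G.restrict (· ≠ v) cs₀).tail e) ↔ q w) := fun e w hw => by
    have hl : Relation.EqvGen ((G.restrict (· ≠ v) cs₀).Link
      {e | (G.restrict (· ≠ v) cs₀).head e ≠ none}) ((G.restrict (· ≠ v) cs₀).tail e) w :=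
      .rel _ _ ⟨e, (fun h => by rw [hw] at h; cases h), rfl, hw⟩
    exact ⟨hl.symm.trans _ _ _, hl.trans _ _ _⟩
  set l₁ := G.concls.filter fun e => ∃ h : G.tail e ≠ v, q ⟨G.tail e, h⟩ with hl₁
  set l₂ := G.concls.filter fun e => ∃ h : G.tail e ≠ v, ¬ q ⟨G.tail e, h⟩ with hl₂
  have hmem₁ : ∀ e, e ∈ l₁ ↔ G.head e = none ∧ ∃ h : G.tail e ≠ v, q ⟨G.tail e, h⟩ :=
    fun e => by rw [hl₁, List.mem_filter, h.graph.mem_concls, decide_eq_true_eq]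
  have hmem₂ : ∀ e, e ∈ l₂ ↔ G.head e = none ∧ ∃ h : G.tail e ≠ v, ¬ q ⟨G.tail e, h⟩ :=
    fun e => by rw [hl₂, List.mem_filter, h.graph.mem_concls, decide_eq_true_eq]
  have hmem : ∀ e, e ∈ l₁ ++ l₂ ↔ G.head e = none ∧ G.tail e ≠ v := fun e => by
    rw [List.mem_append, hmem₁, hmem₂, ← and_or_left, ← exists_or]
    exact and_congr_right fun _ => ⟨fun ⟨h, _⟩ => h, fun h => ⟨h, Classical.em _⟩⟩
  have hn : (l₁ ++ l₂).Nodup := by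
    refine (h.graph.nodup_concls.filter _).append (h.graph.nodup_concls.filter _) fun e h₁ h₂ => ?_
    exact ((hmem₂ e).1 h₂).2.2 ((hmem₁ e).1 h₁).2.2
  obtain ⟨cs, hcs, hr⟩ := h.exists_remove hv hn hmem
  have hi := iso_addNode_induce (c := c) h.graph hv hcs hl
    (d := fun h => c ⟨v, hl.trans h⟩) (fun _ => rfl) rfl (congrArg List.length hprem) hconcl
  -- The cut between the two premises of `v` is also the cut between the sequents of the two
  -- premises of the `⊗` rule.
  have hsplit : cs.map Subtype.val = (l₁ ++ [a]) ++ ([b] ++ l₂) := by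
    rw [hcs, hprem]; simp
  obtain ⟨m₁, m₂, rfl, hm₁, hm₂⟩ := List.map_eq_append_iff.1 hsplit
  have hq₁ : ∀ e ∈ m₁, q ⟨G.tail e.1, e.2⟩ := fun e he => by
    have : e.1 ∈ l₁ ++ [a] := hm₁ ▸ List.mem_map_of_mem he
    rcases List.mem_append.1 this with h | h
    · exact ((hmem₁ _).1 h).2.2
    · obtain rfl : e = ⟨a, hav⟩ := Subtype.ext (by simpa using h)
      exact .refl _
  have hq₂ : ∀ e ∈ m₂, ¬ q ⟨G.tail e.1, e.2⟩ := fun e he => by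
    have : e.1 ∈ [b] ++ l₂ := hm₂ ▸ List.mem_map_of_mem he
    rcases List.mem_append.1 this with h | h
    · obtain rfl : e = ⟨b, hbv⟩ := Subtype.ext (by simpa using h)
      exact hnot
    · exact ((hmem₂ _).1 h).2.2
  have hnd := List.nodup_append'.1 hr.graph.nodup_concls
  have hqclosed' : ∀ e w, (G.restrict (· ≠ v) (m₁ ++ m₂)).head e = some w →
      (¬ q ((G.restrict (· ≠ v) (m₁ ++ m₂)).tail e) ↔ ¬ q w) := fun e w hw =>
    not_iff_not.2 (hqclosed e w hw)
  have hr₁ := hr.restrict_part (p := q) hqclosed (fun e => List.mem_append) hnd.1 hq₂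
  have hr₂ := hr.restrict_part (p := (¬ q ·)) hqclosed'
    (fun e => List.mem_append.trans or_comm) hnd.2.1 fun e he => not_not.2 (hq₁ e he)
  obtain ⟨hc₁, hc₂⟩ := Ground.correct_restrict_of_two_components
    (G := G.restrict (· ≠ v) (m₁ ++ m₂)) (p := q) (cs := m₁.restrictTo _)
    (cs' := m₂.restrictTo _) (fun u => hno u.1) (fun u => hw u.1) hqclosed hcard (.refl _)
    (fun _ h => h) hnot fun u hu => (hcover u).resolve_left hu
  have hu := iso_union_induce (G := G.restrict (· ≠ v) (m₁ ++ m₂))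
    (c := fun u => c ⟨u.1.1, u.2⟩) hr.graph (p := q) hqclosed
    (List.map_val_restrictTo (l := m₁) hq₁) (List.map_val_restrictTo (l := m₂) hq₂)
  have hcard' : ∀ P : {u : G.Node // u ≠ v} → Prop, Nat.card {u // P u} < Nat.card G.Node :=
    fun P => (Finite.card_subtype_le _).trans_lt (card_ne_lt v)
  have hs₁ := ih _ _ (hcard' _) hr₁ hc₁
  have hs₂ := ih _ _ (hcard' _) hr₂ hc₂
  have ht : ∀ (P : {u : G.Node // u ≠ v} → Prop) (m : List {e : G.Arc // G.tail e ≠ v})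
      (hP : ∀ e ∈ m, P ⟨G.tail e.1, e.2⟩),
      (m.restrictTo fun e => P ⟨G.tail e.1, e.2⟩).map (fun e => G.type e.1.1) =
        (m.map Subtype.val).map G.type := fun P m hP => by
    conv_rhs => rw [← List.map_val_restrictTo (l := m) hP, List.map_map, List.map_map]
    rfl
  have ht₁ := ht q m₁ hq₁
  have ht₂ := ht (¬ q ·) m₂ hq₂
  rw [hm₁, List.map_append, List.map_singleton, ha] at ht₁
  rw [hm₂, List.map_append, List.map_singleton, hb] at ht₂
  have ht' : (l₁ ++ G.concl v ++ l₂).map G.type =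
      l₁.map G.type ++ [.tensor A B] ++ l₂.map G.type := by simp [hconcl]
  have hs := (ht₁ ▸ hs₁ : SequentializableAs _ _ _).tensor (ht₂ ▸ hs₂ : SequentializableAs _ _ _)
    (fun C hC => by
      rw [← ht'] at hC
      obtain ⟨e, -, rfl⟩ := List.mem_map.1 hC
      exact h.mem e) fun h => c ⟨v, hl.trans h⟩
  refine h.of_addNode hv hn hmem (hi.trans (hu.addNode (fun _ => .refl _) _ _ _)) ?_
  rw [ht']
  rw [List.length_map] at hs
  exact hs

end PreStructure

-- Polarity and the final induction

/-- A tensor is neither negative nor atomic, so it belongs to the fragment only as a positive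
formula. This is what forbids a `⊗` node below a negative one. -/
theorem isPositive_of_tensor_mem {A B : Formula} (h : Formula.tensor A B ∈ LLpol) :
    IsPositive A ∧ IsPositive B := by
  rcases h with h | h | ⟨n, b, h⟩
  · cases h with | tensor hA hB => exact ⟨hA, hB⟩
  · cases h
  · cases h

/-- The labels of the nodes whose conclusion is negative. -/
def NodeLabel.IsNeg (l : NodeLabel) : Prop :=
  l = .par ∨ l = .con ∨ l = .der ∨ l = .bot ∨ l = .weak

theorem NodeLabel.Typed.exists_of_isNeg {l : NodeLabel} {P Q : List Formula} (h : l.Typed P Q)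
    (hl : l.IsNeg) : ∃ C, Q = [C] ∧ ¬ IsPositive C := by
  rcases hl with rfl | rfl | rfl | rfl | rfl <;> cases h <;> exact ⟨_, rfl, nofun⟩

theorem NodeLabel.Typed.eq_tensor {l : NodeLabel} {P Q : List Formula} (h : l.Typed P Q)
    (hP : P ≠ []) (hl : ¬ l.IsNeg) (hc : l ≠ .cut) :
    l = .tensor ∧ ∃ A B, P = [A, B] ∧ Q = [.tensor A B] := by
  cases h <;> simp_all [NodeLabel.IsNeg]

namespace PreStructure

variable {G : Ground} {c : {v : G.Node // G.label v = .box} → PreStructure}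

/-- Any terminal negative node may be taken as the last rule: adding it is an equivalence for
correctness, so no choice has to be made. -/
theorem Ready.sequentializableAs_of_isNeg (h : Ready G c) (hG : G.Correct)
    (ih : SmallerSequentializable G) {v : G.Node} (hv : ∀ a ∈ G.concl v, G.head a = none)
    (hl : (G.label v).IsNeg) :
    (PreStructure.mk G c).SequentializableAs LLpol (G.concls.map G.type) := by
  have ht := h.typed v (by rcases hl with h | h | h | h | h <;> simp [h])
  generalize hP : (G.prem v).map G.type = P at ht
  generalize hQ : (G.concl v).map G.type = Q at ht
  generalize hl' : G.label v = l at ht hl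
  cases ht with
  | par A B =>
    refine h.sequentializableAs_unary hG ih hv hl' hP hQ (fun H i outs hH hlen hc => ?_)
      fun Γ R d hF hs => hs.par hF d
    obtain ⟨a, ha⟩ := List.exists_mem_of_length_pos (by rw [hlen]; simp)
    exact (Ground.correct_addNode_par_con hH (.inl rfl) ha).1 hc
  | con A =>
    refine h.sequentializableAs_unary hG ih hv hl' hP hQ (fun H i outs hH hlen hc => ?_)
      fun Γ R d hF hs => hs.contraction hF d
    obtain ⟨a, ha⟩ := List.exists_mem_of_length_pos (by rw [hlen]; simp)
    exact (Ground.correct_addNode_par_con hH (.inr rfl) ha).1 hc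
  | der A =>
    refine h.sequentializableAs_unary hG ih hv hl' hP hQ (fun H i outs hH hlen hc => ?_)
      fun Γ R d hF hs => hs.dereliction hF d
    obtain ⟨a, ha⟩ := List.length_eq_one_iff.1 hlen
    exact (Ground.correct_addNode_der hH ha).1 hc
  | bot =>
    exact h.sequentializableAs_unary hG ih hv hl' hP hQ
      (fun H i outs hH _ hc => (Ground.correct_addNode_bot_weak hH (.inl rfl)).1 hc)
      fun Γ R d hF hs => SequentializableAs.bot (by simpa using hs) hF d
  | weak A =>
    exact h.sequentializableAs_unary hG ih hv hl' hP hQ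
      (fun H i outs hH _ hc => (Ground.correct_addNode_bot_weak hH (.inr rfl)).1 hc)
      fun Γ R d hF hs => SequentializableAs.weakening (by simpa using hs) hF d
  | _ => simp [NodeLabel.IsNeg] at hl

/-- A node with premises is a `⊗` node unless its conclusion is negative. -/
theorem Ready.label_eq_tensor (h : Ready G c) {a : G.Arc} {w : G.Node} (ha : G.head a = some w)
    (hw : ¬ (G.label w).IsNeg) : G.label w = .tensor ∧ ∃ A B,
      (G.prem w).map G.type = [A, B] ∧ (G.concl w).map G.type = [.tensor A B] := by
  have hmem := (h.graph.mem_prem w a).2 ha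
  have hbox : G.label w ≠ .box := fun hb => by
    rw [(h.box ⟨w, hb⟩).1] at hmem
    simp at hmem
  refine (h.typed w hbox).eq_tensor ?_ hw (h.label_ne_cut w)
  exact fun h0 => by simp [List.map_eq_nil_iff.1 h0] at hmem

/-- Take a negative node with no negative successor. If its conclusion had a head, that head would
be a `⊗` node, whose premises are positive, whereas the conclusion of a negative node never is. -/
theorem Ready.exists_isNeg_conclusion (h : Ready G c) (hex : ∃ v, (G.label v).IsNeg) :
    ∃ v, (G.label v).IsNeg ∧ ∀ a ∈ G.concl v, G.head a = none := by
  obtain ⟨v, hv, hmax⟩ := h.graph.exists_maximal (fun v => (G.label v).IsNeg) hex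
  refine ⟨v, hv, fun a ha => ?_⟩
  by_contra hne
  obtain ⟨w, hw⟩ := Option.ne_none_iff_exists'.1 hne
  obtain ⟨-, A, B, hP, hQ⟩ := h.label_eq_tensor hw (hmax a w ((h.graph.mem_concl v a).1 ha) hw)
  obtain ⟨C, hC, hneg⟩ :=
    (h.typed v (by rcases hv with h | h | h | h | h <;> simp [h])).exists_of_isNeg hv
  have hQmem : Formula.tensor A B ∈ LLpol := by
    have : Formula.tensor A B ∈ (G.concl w).map G.type := by simp [hQ]
    obtain ⟨e, -, he⟩ := List.mem_map.1 this
    exact he ▸ h.mem e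
  have h₁ : G.type a ∈ (G.prem w).map G.type :=
    List.mem_map_of_mem ((h.graph.mem_prem w a).2 hw)
  have h₂ : G.type a ∈ (G.concl v).map G.type := List.mem_map_of_mem ha
  rw [hP] at h₁
  rw [hC, List.mem_singleton] at h₂
  obtain ⟨hA, hB⟩ := isPositive_of_tensor_mem hQmem
  rcases List.mem_pair.1 h₁ with h₁ | h₁
  · exact hneg (h₂ ▸ h₁ ▸ hA)
  · exact hneg (h₂ ▸ h₁ ▸ hB)

theorem Ready.sequentializableAs_leaf (h : Ready G c) {v : G.Node} (hv : ∀ u, u = v)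
    (hprem : G.prem v = []) (hneg : ¬ (G.label v).IsNeg) :
    (PreStructure.mk G c).SequentializableAs LLpol (G.concls.map G.type) := by
  have hF : ∀ C ∈ (G.concl v).map G.type, C ∈ LLpol := fun C hC => by
    obtain ⟨a, -, rfl⟩ := List.mem_map.1 hC
    exact h.mem a
  by_cases hb : G.label v = .box
  · obtain ⟨-, Γ, A, ⟨π, hπ, hi⟩, ho⟩ := h.box ⟨v, hb⟩
    rw [ho] at hF
    exact h.sequentializableAs_of_unique hv hprem hb ho
      ⟨.promotion π, ⟨hF, hπ⟩, (Iso.refl _).addNode (fun _ => hi) _ _ _⟩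
  · have ht := h.typed v hb
    have hcut := h.label_ne_cut v
    generalize hP : (G.prem v).map G.type = P at ht
    generalize hQ : (G.concl v).map G.type = Q at ht hF
    generalize hl : G.label v = l at ht hneg hcut
    rw [hprem] at hP
    cases ht with
    | ax A =>
      exact h.sequentializableAs_of_unique hv hprem hl hQ
        ⟨.ax A, hF, (Iso.refl _).addNode (l := .ax) (fun h => by cases h) _ _ _⟩
    | one =>
      exact h.sequentializableAs_of_unique hv hprem hl hQ
        ⟨.one, hF, (Iso.refl _).addNode (l := .one) (fun h => by cases h) _ _ _⟩
    | cut A => exact (hcut rfl).elim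
    | tensor A B => simp at hP
    | _ => simp [NodeLabel.IsNeg] at hneg

/-- Strong induction on the number of ground nodes. Boxes count as single nodes, their contents
being already sequentialized by the invariant. -/
theorem Ready.sequentializableAs (h : Ready G c) (hG : G.Correct) :
    (PreStructure.mk G c).SequentializableAs LLpol (G.concls.map G.type) := by
  obtain ⟨n, hn⟩ : ∃ n, Nat.card G.Node = n := ⟨_, rfl⟩
  induction n using Nat.strong_induction_on generalizing G with
  | _ n IH =>
  subst hn
  have ih : SmallerSequentializable G := fun H d hlt hr hc => IH _ hlt hr hc rfl
  have := h.graph.finite_node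
  by_cases hneg : ∃ v, (G.label v).IsNeg
  · obtain ⟨v, hv, hv'⟩ := h.exists_isNeg_conclusion hneg
    exact h.sequentializableAs_of_isNeg hG ih hv' hv
  push Not at hneg
  have hno : ∀ u, ¬ (G.label u = .par ∨ G.label u = .con) := fun u hu =>
    hneg u (by unfold NodeLabel.IsNeg; tauto)
  have hw : ∀ u, ¬ (G.label u = .bot ∨ G.label u = .weak) := fun u hu =>
    hneg u (by unfold NodeLabel.IsNeg; tauto)
  by_cases hhead : ∃ a w, G.head a = some w
  · obtain ⟨a₀, w₀, h₀⟩ := hhead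
    -- A node with premises is here a `⊗`; one that is last among these has its conclusion as a
    -- conclusion of the structure.
    obtain ⟨v, ⟨a, ha⟩, hmax⟩ := h.graph.exists_maximal (fun v => ∃ a, G.head a = some v)
      ⟨w₀, a₀, h₀⟩
    obtain ⟨hl, A, B, hP, hQ⟩ := h.label_eq_tensor ha (hneg v)
    have hv : ∀ e ∈ G.concl v, G.head e = none := fun e he => by
      by_contra hne
      obtain ⟨w, hw⟩ := Option.ne_none_iff_exists'.1 hne
      exact hmax e w ((h.graph.mem_concl v e).1 he) hw ⟨e, hw⟩
    obtain ⟨x, l, hx, hxA, hl'⟩ := List.map_eq_cons_iff.1 hP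
    obtain ⟨y, l', rfl, hyB, hl''⟩ := List.map_eq_cons_iff.1 hl'
    obtain rfl := List.map_eq_nil_iff.1 hl''
    exact h.sequentializableAs_tensor hG ih hv hno hw hl hx hxA hyB hQ
  · push Not at hhead
    have hnone : ∀ a, G.head a = none := fun a =>
      Option.eq_none_iff_forall_ne_some.2 fun w hw => hhead a w hw
    -- With no live arc and `numW = 0`, the node equation of the criterion leaves exactly one node.
    have hc := (hG _ ((Ground.isLive_iff_of_forall_not hno _).2 rfl)).2
    have hempty : {a | G.head a ≠ none} = ∅ := by simp [hnone]
    rw [hempty, Set.ncard_empty, Ground.numW_eq_zero hw] at hc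
    obtain ⟨v, hv⟩ := Nat.card_eq_one_iff_exists.1 hc
    refine h.sequentializableAs_leaf hv (List.eq_nil_iff_forall_not_mem.2 fun a ha => ?_) (hneg v)
    simp [h.graph.mem_prem, hnone] at ha

/-- Acyclicity and the count of the components, in terms of nodes and arcs only. -/
theorem accw_iff_correct {R : PreStructure} (hR : R.IsProofStructure) : R.ACCw ↔ R.Correct := by
  induction R with
  | mk G c ih =>
  obtain ⟨hG, -, hc⟩ := hR
  have := hG.finite_node
  have := hG.finite_arc
  have hi : (∀ v, (c v).ACCw) ↔ ∀ v, (c v).Correct :=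
    forall_congr' fun v => ih v (hc v).2.1
  have hloop : ∀ a, G.head a ≠ some (G.tail a) := fun a ha => hG.dag _ (.single ⟨a, rfl, ha⟩)
  rw [Correct, Ground.correct_iff hloop, ← hi]
  simp only [ACCw, AC, Cw, forall_and]
  tauto

/-- Induction on the nesting of boxes: the proofs obtained for the contents are the premises of the
promotion rules. -/
theorem sequentializableAs_of_correct {R : PreStructure} (hR : R.IsProofStructure)
    (hpol : R.InFragment LLpol) (hcut : R.CutFree) (h : R.Correct) :
    R.SequentializableAs LLpol R.conclTypes := by
  induction R with
  | mk G c ih =>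
  obtain ⟨hG, ht, hc⟩ := hR
  refine Ready.sequentializableAs ⟨hG, ht, hpol.1, hcut.1, fun v => ?_⟩ h.1
  obtain ⟨hp, hv, Γ, A, hΓ, ho⟩ := hc v
  exact ⟨hp, Γ, A, hΓ ▸ ih v hv (hpol.2 v) (hcut.2 v) (h.2 v), ho⟩

end PreStructure

end MELL

/-- A cut-free proof-structure of the polarized fragment satisfies the connectivity-counting
criterion if and only if it is sequentializable in the polarized fragment. -/
theorem mainTheorem8 (R : MELL.PreStructure) (hR : R.IsProofStructure)
    (hpol : R.InFragment MELL.LLpol) (hcut : R.CutFree) :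
    R.ACCw ↔ R.Sequentializable MELL.LLpol := by
  rw [MELL.PreStructure.accw_iff_correct hR]
  constructor
  · exact fun h => ⟨_, MELL.PreStructure.sequentializableAs_of_correct hR hpol hcut h⟩
  · rintro ⟨Γ, π, -, h⟩
    exact π.sound_deseq.correct.of_iso h.symm
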